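/- Let $\mathbb H$ be a real Hilbert space and $A:D(A)\subset\mathbb H\to\mathbb H$ a self-adjoint operator admitting an orthonormal eigenbasis $\{\phi_n\}_{n\ge1}$ of $\mathbb H$, $A\phi_n=\lambda_n\phi_n$, with $0<\lambda_1\le\lambda_2\le\dots$ and $\lambda_n\to+\infty$. Let $\gamma\in(0,1)$, $T>0$ and $b\ge1$. For $t\in(0,T)$ let $$\frac{\partial^\gamma u}{\partial t^\gamma}(t)=\frac1{\Gamma(1-\gamma)}\int_0^t(t-s)^{-\gamma}u'(s)\,ds$$ denote the Caputo derivative. For $p>0$ let $D(A^p)=\{\psi\in\mathbb H:\sum_n\lambda_n^{2p}\langle\psi,\phi_n\rangle^2<\infty\}$ and $\|\psi\|_p=\big(\sum_n\lambda_n^{2p}\langle\psi,\phi_n\rangle^2\big)^{1/2}$. For $\alpha>0$ let $A_\alpha=(I+\alpha A^b)^{-1}A$, extended to a bounded operator on $\mathbb H$, that is, $A_\alpha v=\sum_n\frac{\lambda_n}{1+\alpha\lambda_n^b}\langle v,\phi_n\rangle\phi_n$ for all $v\in\mathbb H$. For $f\in\mathbb H$ consider the regularized problem $$\frac{\partial^\gamma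 v_\alpha}{\partial t^\gamma}+A_\alpha v_\alpha=0\quad(0<t<T),\qquad v_\alpha(T)=f.\tag{1}$$ Solutions of this and of the equation below are functions in $C([0,T];\mathbb H)\cap C^1((0,T);\mathbb H)$ for which the integral defining the Caputo derivative exists (as a Bochner integral) for every $t\in(0,T)$ and the equation holds for every $t\in(0,T)$. For every $\alpha>0$, problem (1) is well-posed: for each $f\in\mathbb H$ it has exactly one solution $v_\alpha$ on $[0,T]$, and $v_\alpha$ depends continuously on $f$, that is, there is a constant $K$ such that solutions $v,w$ with data $f,g$ satisfy $\|v(t)-w(t)\|\le K\|f-g\|$ for all $t\in[0,T]$. Moreover, let $0<\varepsilon<E$, let $u$ be a solution of $\frac{\partial^\gamma u}{\partial t^\gamma}+Au=0$ for $0<t<T$ (with $u(t)\in D(A)$ for $0<t<T$), let $f\in\mathbb H$ satisfy $\|u(T)-f\|\le\varepsilon$, and suppose that $u(0)\in D(A^p)$ and $\|u(0)\|_p\le E$ for some $p>0$. (i) If $0<p<b$ and $\alpha=(\varepsilon/E)^{b/(p+1)}$, then $\|u(0)-v_\alpha(0)\|\le C_1\,\varepsilon^{p/(p+1)}E^{1/(p+1)}$.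 (ii) If $p\ge b$ and $\alpha=(\varepsilon/E)^{b/(b+1)}$, then $\|u(0)-v_\alpha(0)\|\le C_2\,\varepsilon^{b/(b+1)}E^{1/(b+1)}$. Here the constants $C_1,C_2>0$ depend only on $A,\gamma,T,b,p$; they are independent of $\varepsilon$, $E$, $u$ and $f$. -/

import Mathlib

open Set Filter Topology MeasureTheory

noncomputable section

namespace SobolevReg

variable {H : Type*} [NormedAddCommGroup H] [InnerProductSpace ℝ H]

/-- The Caputo derivative of order `γ` of `u` at time `t`:
`1 / Γ(1 - γ) * ∫_0^t (t - s)^(-γ) u'(s) ds` (Bochner integral). -/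
def caputo (γ : ℝ) (u : ℝ → H) (t : ℝ) : H :=
  (1 / Real.Gamma (1 - γ)) • ∫ s in (0 : ℝ)..t, (t - s) ^ (-γ) • deriv u s

/-- The Caputo derivative of `u` at `t` is well defined: its integrand is integrable. -/
def CaputoExists (γ : ℝ) (u : ℝ → H) (t : ℝ) : Prop :=
  IntervalIntegrable (fun s => (t - s) ^ (-γ) • deriv u s) volume 0 t

/-- `u ∈ C([0,T]; H) ∩ C¹((0,T); H)` and the Caputo derivative of order `γ` exists on `(0,T)`. -/
structure IsRegular (γ T : ℝ) (u : ℝ → H) : Prop where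
  continuousOn : ContinuousOn u (Icc 0 T)
  contDiffOn : ContDiffOn ℝ 1 u (Ioo 0 T)
  caputoExists : ∀ t ∈ Ioo 0 T, CaputoExists γ u t

/-- `u` solves the fractional parabolic equation `∂^γ u / ∂t^γ + A u = 0` on `(0,T)`. -/
structure IsParabolicSolution (A : H →ₗ.[ℝ] H) (γ T : ℝ) (u : ℝ → H) : Prop where
  regular : IsRegular γ T u
  equation : ∀ t ∈ Ioo 0 T, ∃ ht : u t ∈ A.domain, caputo γ u t + A ⟨u t, ht⟩ = 0

/-- The domain `D(A^p)` of the fractional power, for `A` with eigenbasis `φ` and eigenvalues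
`lam`. -/
def powDomain (φ : HilbertBasis ℕ ℝ H) (lam : ℕ → ℝ) (p : ℝ) : Set H :=
  {ψ | Summable fun n => lam n ^ (2 * p) * inner ℝ ψ (φ n) ^ 2}

/-- The norm `‖ψ‖_p` on `D(A^p)`. -/
def powNorm (φ : HilbertBasis ℕ ℝ H) (lam : ℕ → ℝ) (p : ℝ) (ψ : H) : ℝ :=
  Real.sqrt (∑' n, lam n ^ (2 * p) * inner ℝ ψ (φ n) ^ 2)

/-- The fractional power `A^b v = ∑ λ_n^b ⟨v, φ_n⟩ φ_n`, for `v ∈ D(A^b)`. -/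
def powOp (φ : HilbertBasis ℕ ℝ H) (lam : ℕ → ℝ) (b : ℝ) (v : H) : H :=
  ∑' n, (lam n ^ b * inner ℝ v (φ n)) • φ n

/-- The bounded operator `A_α = (I + α A^b)⁻¹ A`, that is
`A_α v = ∑ λ_n / (1 + α λ_n^b) ⟨v, φ_n⟩ φ_n`, defined for all `v` in `H`. It is literally
`(I + α A^b)⁻¹ A` on `D(A)` (see `eq_regOp_iff`) and, since it is bounded
(see `exists_norm_regOp_le`), it is the continuous extension of that operator from the
dense subspace `D(A)`. -/
def regOp (φ : HilbertBasis ℕ ℝ H) (lam : ℕ → ℝ) (α b : ℝ) (v : H) : H :=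
  ∑' n, (lam n / (1 + α * lam n ^ b) * inner ℝ v (φ n)) • φ n

/-- `v` solves the regularized problem `∂^γ v / ∂t^γ + A_α v = 0` on `(0,T)`, `v(T) = f`. -/
structure IsRegularizedSolution (φ : HilbertBasis ℕ ℝ H) (lam : ℕ → ℝ) (γ T α b : ℝ) (f : H)
    (v : ℝ → H) : Prop where
  regular : IsRegular γ T v
  equation : ∀ t ∈ Ioo 0 T, caputo γ v t + regOp φ lam α b (v t) = 0
  final : v T = f

/-- The regularized problem is well-posed in the sense of Hadamard: for every datum `f ∈ H` there
is a solution, it is unique (on `[0,T]`), and it depends continuously on the datum, uniformly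
on `[0,T]` (the problem being linear, continuity is a Lipschitz estimate). -/
structure IsWellPosed (φ : HilbertBasis ℕ ℝ H) (lam : ℕ → ℝ) (γ T α b : ℝ) : Prop where
  existence : ∀ f : H, ∃ v : ℝ → H, IsRegularizedSolution φ lam γ T α b f v
  uniqueness : ∀ (f : H) (v w : ℝ → H), IsRegularizedSolution φ lam γ T α b f v →
    IsRegularizedSolution φ lam γ T α b f w → EqOn v w (Icc 0 T)
  stability : ∃ K : ℝ, ∀ (f g : H) (v w : ℝ → H), IsRegularizedSolution φ lam γ T α b f v →
    IsRegularizedSolution φ lam γ T α b g w → ∀ t ∈ Icc 0 T, ‖v t - w t‖ ≤ K * ‖f - g‖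

/-! ### The operator `A_α` is the bounded extension of `(I + α A^b)⁻¹ A` -/

theorem diag_aux (φ : HilbertBasis ℕ ℝ H) (c : ℕ → ℝ) (hc : Summable fun n => c n ^ 2) :
    (∀ m, inner ℝ (∑' n, c n • φ n) (φ m) = c m) ∧
      ‖∑' n, c n • φ n‖ ^ 2 = ∑' n, c n ^ 2 := by
  have hmem : Memℓp c 2 := by
    refine (memℓp_gen_iff (by norm_num)).2 ?_
    simpa using hc
  have hs := φ.hasSum_repr_symm ⟨c, hmem⟩
  have he : ∑' n, c n • φ n = φ.repr.symm ⟨c, hmem⟩ := hs.tsum_eq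
  refine ⟨fun m => ?_, ?_⟩
  · rw [he, real_inner_comm, ← φ.repr_apply_apply, LinearIsometryEquiv.apply_symm_apply]
  · rw [he, LinearIsometryEquiv.norm_map]
    have := lp.norm_rpow_eq_tsum (p := 2) (by norm_num) (⟨c, hmem⟩ : lp (fun _ : ℕ => ℝ) 2)
    simpa using this

theorem summable_inner_sq (φ : HilbertBasis ℕ ℝ H) (v : H) :
    HasSum (fun n => inner ℝ v (φ n) ^ 2) (‖v‖ ^ 2) := by
  have h := φ.hasSum_inner_mul_inner v v
  rw [real_inner_self_eq_norm_sq] at h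
  refine h.congr_fun fun n => ?_
  rw [real_inner_comm v (φ n), sq]

theorem ext_inner (φ : HilbertBasis ℕ ℝ H) {v w : H}
    (h : ∀ n, inner ℝ v (φ n) = inner ℝ w (φ n)) : v = w := by
  apply φ.repr.injective
  ext n
  rw [φ.repr_apply_apply, φ.repr_apply_apply, real_inner_comm, h, real_inner_comm]

theorem symbol_le {lam : ℕ → ℝ} (hlam : ∀ n, 0 < lam n) {α b : ℝ} (hα : 0 < α) (hb : 1 ≤ b)
    (n : ℕ) : 0 ≤ lam n / (1 + α * lam n ^ b) ∧ lam n / (1 + α * lam n ^ b) ≤ 1 + 1 / α := by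
  have hl := hlam n
  have hp : 0 < lam n ^ b := Real.rpow_pos_of_pos hl b
  have hd : 0 < 1 + α * lam n ^ b := by positivity
  refine ⟨by positivity, ?_⟩
  rw [div_le_iff₀ hd]
  have e : (1 + 1 / α) * (1 + α * lam n ^ b) = 1 + 1 / α + α * lam n ^ b + lam n ^ b := by
    field_simp
    ring
  have h1 : 0 < 1 / α := by positivity
  have h2 : 0 < α * lam n ^ b := by positivity
  rw [e]
  rcases le_total (lam n) 1 with h | h
  · linarith
  · have := Real.rpow_le_rpow_of_exponent_le h hb
    rw [Real.rpow_one] at this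
    linarith

theorem summable_symbol (φ : HilbertBasis ℕ ℝ H) {lam : ℕ → ℝ} (hlam : ∀ n, 0 < lam n) {α b : ℝ}
    (hα : 0 < α) (hb : 1 ≤ b) (v : H) :
    Summable fun n => (lam n / (1 + α * lam n ^ b) * inner ℝ v (φ n)) ^ 2 := by
  refine Summable.of_nonneg_of_le (fun _ => sq_nonneg _) (fun n => ?_)
    ((summable_inner_sq φ v).summable.mul_left ((1 + 1 / α) ^ 2))
  rw [mul_pow]
  obtain ⟨h0, h1⟩ := symbol_le hlam hα hb n
  gcongr

/-- `A_α` is bounded on `H`. -/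
theorem exists_norm_regOp_le (φ : HilbertBasis ℕ ℝ H) {lam : ℕ → ℝ} (hlam : ∀ n, 0 < lam n)
    {α b : ℝ} (hα : 0 < α) (hb : 1 ≤ b) : ∃ K : ℝ, ∀ v, ‖regOp φ lam α b v‖ ≤ K * ‖v‖ := by
  refine ⟨1 + 1 / α, fun v => ?_⟩
  have hs := summable_symbol φ hlam hα hb v
  have h := (diag_aux φ _ hs).2
  have hK : 0 ≤ (1 + 1 / α) * ‖v‖ := by positivity
  refine le_of_sq_le_sq ?_ hK
  rw [regOp, h, mul_pow, ← (summable_inner_sq φ v).tsum_eq, ← tsum_mul_left]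
  refine hs.tsum_le_tsum (fun n => ?_) ((summable_inner_sq φ v).summable.mul_left _)
  rw [mul_pow]
  obtain ⟨h0, h1⟩ := symbol_le hlam hα hb n
  gcongr

/-- On `D(A)`, `A_α v` is the unique `w ∈ D(A^b)` with `(I + α A^b) w = A v`. -/
theorem eq_regOp_iff [CompleteSpace H] {A : H →ₗ.[ℝ] H} (hA : IsSelfAdjoint A)
    (φ : HilbertBasis ℕ ℝ H) {lam : ℕ → ℝ} (hlam : ∀ n, 0 < lam n)
    (hφ : ∀ n, ∃ h : φ n ∈ A.domain, A ⟨φ n, h⟩ = lam n • φ n)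
    {α b : ℝ} (hα : 0 < α) (hb : 1 ≤ b) (v : A.domain) (w : H) :
    (w ∈ powDomain φ lam b ∧ w + α • powOp φ lam b w = A v) ↔ w = regOp φ lam α b v := by
  have hAv : ∀ n, inner ℝ (A v) (φ n) = lam n * inner ℝ (v : H) (φ n) := by
    intro n
    obtain ⟨h, he⟩ := hφ n
    have hd : Dense (A.domain : Set H) := hA.dense_domain
    have hf := LinearPMap.adjoint_isFormalAdjoint hd
    rw [LinearPMap.isSelfAdjoint_def.1 hA] at hf
    have := hf v ⟨φ n, h⟩
    rw [this, he, inner_smul_right]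
  have hsq : ∀ n, lam n ^ (2 * b) = (lam n ^ b) ^ 2 := by
    intro n
    rw [mul_comm, Real.rpow_mul (hlam n).le]
    norm_cast
  have hpow : ∀ x ∈ powDomain φ lam b, ∀ n,
      inner ℝ (powOp φ lam b x) (φ n) = lam n ^ b * inner ℝ x (φ n) := by
    intro x hx n
    refine (diag_aux φ (fun n => lam n ^ b * inner ℝ x (φ n)) ?_).1 n
    refine (show Summable _ from hx).congr fun n => ?_
    rw [mul_pow, hsq]
  have hreg := (diag_aux φ _ (summable_symbol φ hlam hα hb (v : H))).1
  have hd : ∀ n, 0 < 1 + α * lam n ^ b := fun n => by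
    have := Real.rpow_pos_of_pos (hlam n) b
    positivity
  have hmem : regOp φ lam α b v ∈ powDomain φ lam b := by
    have hAs := ((summable_inner_sq φ (A v)).summable).mul_left ((1 / α) ^ 2)
    refine Summable.of_nonneg_of_le (fun n => ?_) (fun n => ?_) hAs
    · rw [hsq]
      positivity
    · have hp := Real.rpow_pos_of_pos (hlam n) b
      have hdn := hd n
      rw [regOp, hreg, hsq, hAv, ← mul_pow, ← mul_pow, sq_le_sq]
      have e : lam n ^ b * (lam n / (1 + α * lam n ^ b) * inner ℝ (v : H) (φ n)) =
          lam n ^ b / (1 + α * lam n ^ b) * (lam n * inner ℝ (v : H) (φ n)) := by ring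
      rw [e, abs_mul, abs_mul (1 / α)]
      refine mul_le_mul_of_nonneg_right ?_ (abs_nonneg _)
      rw [abs_of_pos (by positivity), abs_of_pos (by positivity), div_le_div_iff₀ hdn hα]
      linarith
  constructor
  · rintro ⟨hw, he⟩
    refine ext_inner φ fun n => ?_
    have := congrArg (fun x => inner ℝ x (φ n)) he
    simp only [inner_add_left, inner_smul_left, hpow w hw, hAv] at this
    rw [regOp, hreg]
    have hdn := (hd n).ne'
    field_simp
    simp only [RCLike.conj_to_real] at this
    linarith
  · rintro rfl
    refine ⟨hmem, ext_inner φ fun n => ?_⟩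
    rw [inner_add_left, inner_smul_left, hpow _ hmem, hAv, regOp, hreg]
    have hdn := (hd n).ne'
    simp only [RCLike.conj_to_real]
    field_simp

end SobolevReg

end

/-!
Taking inner products with the eigenvectors reduces both problems to the scalar relaxation
equation `∂^γ y / ∂t^γ + lam y = 0`, whose only solution with value `y 0` at time zero is
`y t = E_γ(-lam t ^ γ) y 0`, where `E_γ` is the Mittag-Leffler function. Hence, with
`μ n = lam n / (1 + α lam n ^ b)` and `e x = E_γ(-x)`, the coefficients satisfy
`u_n(T) = e (lam n T ^ γ) u_n(0)` and `f_n = e (μ n T ^ γ) v_n(0)`, so that everything rests on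
real-variable properties of the relaxation function `e`.

These come from the extremum principle for the Caputo derivative (`caputo_le_of_min`). At a minimum
of a solution it gives the lower bound `e x ≥ 1 / (1 + Γ(1 - γ) x)` (`inv_le_relax`), and it yields
a comparison principle (`nonneg_of_caputo_add_nonneg`), which gives uniqueness (`eq_mul_relax`) and
the monotonicity of `e`. Monotonicity in the equivalent Volterra equation gives the matching upper
bound (`relax_le_inv`), hence `e (x / 2) ≤ C e x`. Finally, comparing `y_μ - y_lam` with the
supersolution `2 (1 - μ / lam) y_{μ/2}` shows `e μ - e lam ≤ C (1 - μ / lam) e μ` for `μ ≤ lam`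
(`relax_sub_le`).

Well-posedness: since `μ n ≤ 1 + 1 / α`, the numbers `1 / e (μ n T ^ γ)` are bounded, which is the
stability estimate, and uniqueness with it. A solution is the Mittag-Leffler series in `-A_α`; all
its fractional integrals and derivatives are computed by one termwise integration
(`integral_mittagLeffler`), which is the Euler beta integral.

Error estimate: `u_n(0) - v_n(0)` is the sum of `(u_n(T) - f_n) / e (μ n T ^ γ)` and
`u_n(0) (e (μ n T ^ γ) - e (lam n T ^ γ)) / e (μ n T ^ γ)`. The first is at most
`C α ^ (-1/b) |u_n(T) - f_n|` because `μ n ≤ α ^ (-1/b)`, and the second at most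
`C |u_n(0)| α lam n ^ b / (1 + α lam n ^ b)` by `relax_sub_le`; the smoothness of `u(0)` turns this
into a power of `α`, and the choice of `α` balances the two terms.
-/

noncomputable section

namespace SobolevReg

section Series

/-! ### Mittag-Leffler series and their fractional integrals -/

theorem rpow_mul_exp_neg_le_Gamma {R x : ℝ} (hR : 0 < R) (hx : 1 ≤ x) :
    R ^ (x - 1) * Real.exp (-R) ≤ Real.Gamma x := by
  rw [Real.Gamma_eq_integral (by linarith)]
  have hint := Real.GammaIntegral_convergent (s := x) (by linarith)
  have hsub : Ioi R ⊆ Ioi (0 : ℝ) := Ioi_subset_Ioi hR.le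
  calc R ^ (x - 1) * Real.exp (-R) = ∫ s in Ioi R, Real.exp (-s) * R ^ (x - 1) := by
        rw [integral_mul_const, integral_exp_neg_Ioi, mul_comm]
    _ ≤ ∫ s in Ioi R, Real.exp (-s) * s ^ (x - 1) := by
        refine setIntegral_mono_on ((integrableOn_exp_neg_Ioi R).mul_const _)
          (hint.mono_set hsub) measurableSet_Ioi fun s hs => ?_
        have hs' : R ≤ s := (mem_Ioi.1 hs).le
        gcongr
    _ ≤ ∫ s in Ioi 0, Real.exp (-s) * s ^ (x - 1) := by
        refine setIntegral_mono_set hint ?_ hsub.eventuallyLE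
        refine (ae_restrict_iff' measurableSet_Ioi).2 (Eventually.of_forall fun s hs => ?_)
        have : (0 : ℝ) < s := hs
        simp only [Pi.zero_apply]
        positivity

/-- The Mittag-Leffler power series has infinite radius of convergence: since
`Γ x ≥ e ^ (-R) R ^ (x - 1)`, taking `R ^ γ = 2 (q + 1)` makes it dominated by `2 ^ (-k)`. -/
theorem summable_pow_div_Gamma {γ δ q : ℝ} (hγ : 0 < γ) (hδ : 0 < δ) (hq : 0 ≤ q) :
    Summable fun k : ℕ => q ^ k / Real.Gamma (γ * k + δ) := by
  set R : ℝ := (2 * (q + 1)) ^ (1 / γ) with hRdef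
  have hR : 0 < R := by positivity
  have hRγ : R ^ γ = 2 * (q + 1) := by
    rw [hRdef, ← Real.rpow_mul (by positivity), one_div, inv_mul_cancel₀ hγ.ne', Real.rpow_one]
  have hs : Summable fun k : ℕ => (Real.exp R * R ^ (1 - δ)) * (1 / 2 : ℝ) ^ k :=
    (summable_geometric_two).mul_left _
  refine Summable.of_norm_bounded_eventually_nat hs ?_
  filter_upwards [eventually_ge_atTop ⌈1 / γ⌉₊] with k hk
  have hk1 : 1 ≤ γ * k + δ := by
    have : 1 / γ ≤ k := (Nat.le_ceil _).trans (by exact_mod_cast hk)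
    rw [div_le_iff₀ hγ] at this
    nlinarith
  have hΓ := rpow_mul_exp_neg_le_Gamma hR hk1
  have hlow : 0 < R ^ (γ * k + δ - 1) * Real.exp (-R) := by positivity
  rw [Real.norm_of_nonneg (div_nonneg (by positivity) (hlow.le.trans hΓ))]
  have e1 : R ^ (γ * k + δ - 1) = (2 * (q + 1)) ^ k * (R ^ (1 - δ))⁻¹ := by
    rw [← hRγ, ← Real.rpow_natCast, ← Real.rpow_mul hR.le, ← Real.rpow_neg hR.le,
      ← Real.rpow_add hR]
    congr 1
    ring
  calc q ^ k / Real.Gamma (γ * k + δ) ≤ q ^ k / (R ^ (γ * k + δ - 1) * Real.exp (-R)) := by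
        gcongr
    _ = Real.exp R * R ^ (1 - δ) * (q / (2 * (q + 1))) ^ k := by
        rw [e1, Real.exp_neg, div_pow]
        field_simp
    _ ≤ Real.exp R * R ^ (1 - δ) * (1 / 2) ^ k := by
        refine mul_le_mul_of_nonneg_left (pow_le_pow_left₀ (by positivity) ?_ k) (by positivity)
        rw [div_le_div_iff₀ (by positivity) (by norm_num)]
        linarith

theorem integral_sub_rpow_mul_rpow {β c t : ℝ} (hβ : 0 < β) (hc : 0 < c) (ht : 0 < t) :
    ∫ s in (0 : ℝ)..t, (t - s) ^ (β - 1) * s ^ (c - 1) =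
      t ^ (c + β - 1) * (Real.Gamma β * Real.Gamma c / Real.Gamma (c + β)) := by
  have h1 := Complex.betaIntegral_scaled c β ht
  have h2 := Complex.Gamma_mul_Gamma_eq_betaIntegral (s := (c : ℂ)) (t := (β : ℂ))
    (by simpa using hc) (by simpa using hβ)
  have hG : Complex.Gamma ((c : ℂ) + β) ≠ 0 := by
    rw [← Complex.ofReal_add, Complex.Gamma_ofReal]
    exact_mod_cast (Real.Gamma_pos_of_pos (by positivity)).ne'
  have h3 : Complex.betaIntegral c β =
      ((Real.Gamma β * Real.Gamma c / Real.Gamma (c + β) : ℝ) : ℂ) := by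
    push_cast
    rw [← Complex.Gamma_ofReal, ← Complex.Gamma_ofReal, ← Complex.Gamma_ofReal]
    push_cast
    rw [eq_div_iff hG, mul_comm, ← h2, mul_comm]
  have h4 : ((∫ s in (0 : ℝ)..t, (t - s) ^ (β - 1) * s ^ (c - 1) : ℝ) : ℂ) =
      ∫ x in (0 : ℝ)..t, (x : ℂ) ^ ((c : ℂ) - 1) * ((t : ℂ) - x) ^ ((β : ℂ) - 1) := by
    rw [← intervalIntegral.integral_ofReal]
    refine intervalIntegral.integral_congr fun s hs => ?_
    rw [uIcc_of_le ht.le] at hs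
    rw [Complex.ofReal_mul, Complex.ofReal_cpow (by linarith [hs.2]), Complex.ofReal_cpow hs.1]
    push_cast
    ring
  rw [h3] at h1
  have h5 : ((t : ℂ)) ^ ((c : ℂ) + β - 1) = ((t ^ (c + β - 1) : ℝ) : ℂ) := by
    rw [Complex.ofReal_cpow ht.le]
    push_cast
    rfl
  rw [h5, ← h4] at h1
  exact_mod_cast h1

theorem intervalIntegrable_sub_rpow_mul_rpow {β c t : ℝ} (hβ : 0 < β) (hc : 0 < c) (ht : 0 < t) :
    IntervalIntegrable (fun s => (t - s) ^ (β - 1) * s ^ (c - 1)) volume 0 t := by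
  -- A non-integrable function has Bochner integral zero, whereas this integral is positive.
  refine intervalIntegral.intervalIntegrable_of_integral_ne_zero ?_
  rw [integral_sub_rpow_mul_rpow hβ hc ht]
  have := Real.Gamma_pos_of_pos hβ
  have := Real.Gamma_pos_of_pos hc
  have := Real.Gamma_pos_of_pos (add_pos hc hβ)
  positivity

variable {X : Type*} [NormedAddCommGroup X]

/-- The sequence `a` grows at most geometrically. -/
def GeomBounded (a : ℕ → X) : Prop := ∃ C M : ℝ, 0 ≤ M ∧ ∀ k, ‖a k‖ ≤ C * M ^ k

theorem GeomBounded.shift {a : ℕ → X} (ha : GeomBounded a) : GeomBounded fun k => a (k + 1) := by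
  obtain ⟨C, M, hM, h⟩ := ha
  exact ⟨C * M, M, hM, fun k => (h (k + 1)).trans_eq (by ring)⟩

variable [NormedSpace ℝ X]

/-- The vector-valued Mittag-Leffler series `∑ t ^ (γ k) / Γ(γ k + δ) a_k`. For `a k = B ^ k x` it
is `E_{γ,δ}(t ^ γ B) x`, where `E_{γ,δ}` is the two-parameter Mittag-Leffler function. -/
def mittagLeffler (γ δ : ℝ) (a : ℕ → X) (t : ℝ) : X :=
  ∑' k : ℕ, (t ^ (γ * k) / Real.Gamma (γ * k + δ)) • a k

theorem mittagLeffler_bound {γ δ : ℝ} (hγ : 0 < γ) (hδ : 0 < δ) {a : ℕ → X} (ha : GeomBounded a)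
    {R : ℝ} (hR : 0 ≤ R) : ∃ g : ℕ → ℝ, Summable g ∧
      ∀ (k : ℕ), ∀ t ∈ Icc 0 R, ‖(t ^ (γ * k) / Real.Gamma (γ * k + δ)) • a k‖ ≤ g k := by
  obtain ⟨C, M, hM, h⟩ := ha
  refine ⟨fun k => C * ((R ^ γ * M) ^ k / Real.Gamma (γ * k + δ)),
    (summable_pow_div_Gamma hγ hδ (by positivity)).mul_left C, fun k t ht => ?_⟩
  have hΓ : 0 < Real.Gamma (γ * k + δ) := Real.Gamma_pos_of_pos (by positivity)
  have h0 : 0 ≤ t ^ (γ * k) := Real.rpow_nonneg ht.1 _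
  rw [norm_smul, Real.norm_of_nonneg (by positivity)]
  calc t ^ (γ * k) / Real.Gamma (γ * k + δ) * ‖a k‖
      ≤ R ^ (γ * k) / Real.Gamma (γ * k + δ) * (C * M ^ k) := by
        have := ht.1
        have := ht.2
        gcongr
        exact h k
    _ = C * ((R ^ γ * M) ^ k / Real.Gamma (γ * k + δ)) := by
        rw [Real.rpow_mul hR, Real.rpow_natCast, mul_pow]
        ring

theorem continuousOn_rpow_div_Gamma {γ : ℝ} (hγ : 0 < γ) (δ : ℝ) (k : ℕ) (x : X) (s : Set ℝ) :
    ContinuousOn (fun t : ℝ => (t ^ (γ * k) / Real.Gamma (γ * k + δ)) • x) s :=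
  (((Real.continuous_rpow_const (by positivity)).div_const _).smul continuous_const).continuousOn

theorem summable_norm_mittagLeffler {γ δ : ℝ} (hγ : 0 < γ) (hδ : 0 < δ) {a : ℕ → X}
    (ha : GeomBounded a) {t : ℝ} (ht : 0 ≤ t) :
    Summable fun k : ℕ => ‖(t ^ (γ * k) / Real.Gamma (γ * k + δ)) • a k‖ := by
  obtain ⟨g, hg, h⟩ := mittagLeffler_bound hγ hδ ha ht
  exact Summable.of_nonneg_of_le (fun _ => norm_nonneg _) (fun k => h k t ⟨ht, le_rfl⟩) hg

theorem mittagLeffler_zero {γ : ℝ} (hγ : 0 < γ) (a : ℕ → X) : mittagLeffler γ 1 a 0 = a 0 := by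
  rw [mittagLeffler, tsum_eq_single 0]
  · simp
  · intro k hk
    rw [Real.zero_rpow (by positivity), zero_div, zero_smul]

variable [CompleteSpace X]

theorem summable_mittagLeffler {γ δ : ℝ} (hγ : 0 < γ) (hδ : 0 < δ) {a : ℕ → X}
    (ha : GeomBounded a) {t : ℝ} (ht : 0 ≤ t) :
    Summable fun k : ℕ => (t ^ (γ * k) / Real.Gamma (γ * k + δ)) • a k :=
  (summable_norm_mittagLeffler hγ hδ ha ht).of_norm

theorem continuousOn_mittagLeffler {γ δ : ℝ} (hγ : 0 < γ) (hδ : 0 < δ) {a : ℕ → X}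
    (ha : GeomBounded a) {R : ℝ} (hR : 0 ≤ R) :
    ContinuousOn (mittagLeffler γ δ a) (Icc 0 R) := by
  obtain ⟨g, hg, h⟩ := mittagLeffler_bound hγ hδ ha hR
  exact continuousOn_tsum (fun k => continuousOn_rpow_div_Gamma hγ δ k (a k) _) hg h

theorem intervalIntegrable_mittagLeffler {γ δ β : ℝ} (hγ : 0 < γ) (hδ : 0 < δ) (hβ : 0 < β)
    {a : ℕ → X} (ha : GeomBounded a) {t : ℝ} (ht : 0 < t) :
    IntervalIntegrable (fun s => (t - s) ^ (β - 1) • s ^ (δ - 1) • mittagLeffler γ δ a s)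
      volume 0 t := by
  have h1 := intervalIntegrable_sub_rpow_mul_rpow hβ hδ ht
  have h2 := continuousOn_mittagLeffler hγ hδ ha ht.le
  rw [← uIcc_of_le ht.le] at h2
  refine (h1.smul_continuousOn h2).congr fun s _ => ?_
  simp only [smul_smul]

/-- The fractional integral of order `β` of `s ^ (δ - 1) E_{γ,δ}` is
`s ^ (δ + β - 1) E_{γ,δ+β}`. -/
theorem integral_mittagLeffler {γ δ β : ℝ} (hγ : 0 < γ) (hδ : 0 < δ) (hβ : 0 < β)
    {a : ℕ → X} (ha : GeomBounded a) {t : ℝ} (ht : 0 < t) :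
    ∫ s in (0 : ℝ)..t, (t - s) ^ (β - 1) • s ^ (δ - 1) • mittagLeffler γ δ a s =
      Real.Gamma β • t ^ (δ + β - 1) • mittagLeffler γ (δ + β) a t := by
  set κ : ℕ → ℝ → ℝ := fun k s =>
    ((t - s) ^ (β - 1) * s ^ (γ * k + δ - 1)) * (1 / Real.Gamma (γ * k + δ)) with hκ
  set F : ℕ → ℝ → X := fun k s => κ k s • a k with hF
  have hc : ∀ k : ℕ, 0 < γ * k + δ := fun k => by positivity
  have hint : ∀ k, IntegrableOn (κ k) (Ioc 0 t) := fun k =>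
    ((intervalIntegrable_iff_integrableOn_Ioc_of_le ht.le).1
      (intervalIntegrable_sub_rpow_mul_rpow hβ (hc k) ht)).mul_const _
  have hval : ∀ k, ∫ s in Ioc 0 t, κ k s = (Real.Gamma β * t ^ (δ + β - 1)) *
      (t ^ (γ * k) / Real.Gamma (γ * k + (δ + β))) := by
    intro k
    rw [integral_mul_const, ← intervalIntegral.integral_of_le ht.le,
      integral_sub_rpow_mul_rpow hβ (hc k) ht]
    have h1 := (Real.Gamma_pos_of_pos (hc k)).ne'
    have e : t ^ (γ * k + δ + β - 1) = t ^ (δ + β - 1) * t ^ (γ * k) := by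
      rw [← Real.rpow_add ht]
      congr 1
      ring
    rw [e, ← add_assoc]
    field_simp
  have hnorm : ∀ k, ∫ s in Ioc 0 t, ‖F k s‖ = (Real.Gamma β * t ^ (δ + β - 1)) *
      ‖(t ^ (γ * k) / Real.Gamma (γ * k + (δ + β))) • a k‖ := by
    intro k
    have hpos : 0 < Real.Gamma (γ * k + (δ + β)) := Real.Gamma_pos_of_pos (by positivity)
    rw [norm_smul, Real.norm_of_nonneg (by positivity), ← mul_assoc, ← hval k,
      ← integral_mul_const]
    refine setIntegral_congr_fun measurableSet_Ioc fun s hs => ?_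
    have h1 : 0 < Real.Gamma (γ * k + δ) := Real.Gamma_pos_of_pos (hc k)
    have h2 : 0 ≤ t - s := by linarith [hs.2]
    have h3 : 0 < s := hs.1
    have h4 : 0 ≤ κ k s := by
      simp only [hκ]
      positivity
    simp only [hF]
    rw [norm_smul, Real.norm_of_nonneg h4]
  have hsum := hasSum_integral_of_summable_integral_norm (μ := volume.restrict (Ioc 0 t))
    (F := F) (fun k => (hint k).smul_const (a k)) (by
      simp_rw [hnorm]
      exact (summable_norm_mittagLeffler hγ (by positivity) ha ht.le).mul_left _)
  rw [intervalIntegral.integral_of_le ht.le, smul_smul, mittagLeffler,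
    ← (summable_mittagLeffler hγ (by positivity) ha ht.le).tsum_const_smul]
  have e : ∫ s in Ioc 0 t, (t - s) ^ (β - 1) • s ^ (δ - 1) • mittagLeffler γ δ a s =
      ∫ s in Ioc 0 t, ∑' k, F k s := by
    refine setIntegral_congr_fun measurableSet_Ioc fun s hs => ?_
    have h3 : 0 < s := hs.1
    simp only [hF, hκ]
    rw [smul_smul, mittagLeffler,
      ← (summable_mittagLeffler hγ (by positivity) ha h3.le).tsum_const_smul]
    refine tsum_congr fun k => ?_
    rw [smul_smul]
    congr 1
    have : s ^ (γ * k + δ - 1) = s ^ (δ - 1) * s ^ (γ * k) := by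
      rw [← Real.rpow_add h3]
      congr 1
      ring
    rw [this]
    ring
  rw [e, ← hsum.tsum_eq]
  exact tsum_congr fun k => by rw [integral_smul_const, hval, smul_smul]

theorem mittagLeffler_one_eq {γ : ℝ} (hγ : 0 < γ) {a : ℕ → X} (ha : GeomBounded a) {t : ℝ}
    (ht : 0 < t) :
    mittagLeffler γ 1 a t = a 0 + t ^ γ • mittagLeffler γ (γ + 1) (fun k => a (k + 1)) t := by
  rw [mittagLeffler, (summable_mittagLeffler hγ one_pos ha ht.le).tsum_eq_zero_add, mittagLeffler,
    ← (summable_mittagLeffler hγ (by positivity) ha.shift ht.le).tsum_const_smul]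
  congr 1
  · simp
  · refine tsum_congr fun k => ?_
    rw [smul_smul]
    congr 1
    have : t ^ (γ * ((k + 1 : ℕ) : ℝ)) = t ^ γ * t ^ (γ * k) := by
      rw [← Real.rpow_add ht]
      congr 1
      push_cast
      ring
    rw [this, mul_div_assoc]
    congr 3
    push_cast
    ring

theorem hasDerivAt_mittagLeffler {γ : ℝ} (hγ : 0 < γ) {a : ℕ → X} (ha : GeomBounded a) {t : ℝ}
    (ht : 0 < t) : HasDerivAt (mittagLeffler γ 1 a)
      (t ^ (γ - 1) • mittagLeffler γ γ (fun k => a (k + 1)) t) t := by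
  set w : ℝ → X := fun s => s ^ (γ - 1) • mittagLeffler γ γ (fun k => a (k + 1)) s with hw
  have hwi : ∀ x, 0 < x → IntervalIntegrable w volume 0 x := fun x hx => by
    simpa using intervalIntegrable_mittagLeffler hγ hγ one_pos ha.shift hx
  have hrep : ∀ x, 0 < x → mittagLeffler γ 1 a x = a 0 + ∫ s in (0 : ℝ)..x, w s := by
    intro x hx
    have := integral_mittagLeffler hγ hγ one_pos ha.shift hx
    rw [mittagLeffler_one_eq hγ ha hx]
    simp only [sub_self, Real.rpow_zero, one_smul, Real.Gamma_one, add_sub_cancel_right] at this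
    rw [this]
  have hwc : ContinuousOn w (Ioo 0 (t + 1)) := by
    refine ContinuousOn.smul (fun s hs => ?_)
      ((continuousOn_mittagLeffler hγ hγ ha.shift (by positivity)).mono Ioo_subset_Icc_self)
    exact (Real.continuousAt_rpow_const _ _ (Or.inl hs.1.ne')).continuousWithinAt
  have hmem : Ioo 0 (t + 1) ∈ 𝓝 t := Ioo_mem_nhds ht (by linarith)
  have hd := intervalIntegral.integral_hasDerivAt_right (hwi t ht)
    (hwc.stronglyMeasurableAtFilter isOpen_Ioo t ⟨ht, by linarith⟩) (hwc.continuousAt hmem)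
  refine (hd.const_add (a 0)).congr_of_eventuallyEq ?_
  filter_upwards [Ioi_mem_nhds ht] with x hx using hrep x hx

variable {H : Type*} [NormedAddCommGroup H] [InnerProductSpace ℝ H] [CompleteSpace H]

theorem isRegular_mittagLeffler {γ T : ℝ} (hγ0 : 0 < γ) (hγ1 : γ < 1) (hT : 0 < T) {a : ℕ → H}
    (ha : GeomBounded a) : IsRegular γ T (mittagLeffler γ 1 a) := by
  refine ⟨continuousOn_mittagLeffler hγ0 one_pos ha hT.le, ?_, fun t ht => ?_⟩
  · have hd : ∀ t ∈ Ioo 0 T, deriv (mittagLeffler γ 1 a) t =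
        t ^ (γ - 1) • mittagLeffler γ γ (fun k => a (k + 1)) t := fun t ht =>
      (hasDerivAt_mittagLeffler hγ0 ha ht.1).deriv
    rw [show (1 : WithTop ℕ∞) = 0 + 1 by simp, contDiffOn_succ_iff_deriv_of_isOpen isOpen_Ioo]
    refine ⟨fun t ht =>
      (hasDerivAt_mittagLeffler hγ0 ha ht.1).differentiableAt.differentiableWithinAt,
      by simp, contDiffOn_zero.2 (ContinuousOn.congr ?_ hd)⟩
    refine ContinuousOn.smul (fun s hs => ?_)
      ((continuousOn_mittagLeffler hγ0 hγ0 ha.shift hT.le).mono Ioo_subset_Icc_self)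
    exact (Real.continuousAt_rpow_const _ _ (Or.inl hs.1.ne')).continuousWithinAt
  · have := intervalIntegrable_mittagLeffler hγ0 hγ0 (β := 1 - γ) (by linarith) ha.shift ht.1
    refine this.congr fun s hs => ?_
    rw [uIoc_of_le ht.1.le] at hs
    rw [(hasDerivAt_mittagLeffler hγ0 ha hs.1).deriv, show 1 - γ - 1 = -γ by ring]

/-- The Caputo derivative acts on Mittag-Leffler series as the shift of the coefficients. -/
theorem caputo_mittagLeffler {γ : ℝ} (hγ0 : 0 < γ) (hγ1 : γ < 1) {a : ℕ → H}
    (ha : GeomBounded a) {t : ℝ} (ht : 0 < t) :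
    caputo γ (mittagLeffler γ 1 a) t = mittagLeffler γ 1 (fun k => a (k + 1)) t := by
  have h := integral_mittagLeffler hγ0 hγ0 (β := 1 - γ) (by linarith) ha.shift ht
  have hΓ := (Real.Gamma_pos_of_pos (sub_pos.2 hγ1)).ne'
  rw [show γ + (1 - γ) - 1 = 0 by ring, show γ + (1 - γ) = 1 by ring, Real.rpow_zero,
    one_smul] at h
  have e : ∫ s in (0 : ℝ)..t, (t - s) ^ (-γ) • deriv (mittagLeffler γ 1 a) s =
      ∫ s in (0 : ℝ)..t, (t - s) ^ (1 - γ - 1) • s ^ (γ - 1) •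
        mittagLeffler γ γ (fun k => a (k + 1)) s := by
    rw [intervalIntegral.integral_of_le ht.le, intervalIntegral.integral_of_le ht.le]
    refine setIntegral_congr_fun measurableSet_Ioc fun s hs => ?_
    rw [(hasDerivAt_mittagLeffler hγ0 ha hs.1).deriv, show 1 - γ - 1 = -γ by ring]
  rw [caputo, e, h, smul_smul, one_div, inv_mul_cancel₀ hΓ, one_smul]

end Series

/-! ### Linearity of the Caputo derivative -/

section Linear

variable {H : Type*} [NormedAddCommGroup H] [InnerProductSpace ℝ H]

theorem IsRegular.hasDerivAt {γ T : ℝ} {u : ℝ → H} (hu : IsRegular γ T u) {t : ℝ}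
    (ht : t ∈ Ioo 0 T) : HasDerivAt u (deriv u t) t :=
  ((hu.contDiffOn.differentiableOn one_ne_zero).differentiableAt
    (Ioo_mem_nhds ht.1 ht.2)).hasDerivAt

theorem caputo_integrand_congr {γ t : ℝ} (ht : 0 < t) {u : ℝ → H} {g : ℝ → H}
    (h : ∀ s ∈ Ioc 0 t, deriv u s = g s) :
    ∫ s in (0 : ℝ)..t, (t - s) ^ (-γ) • deriv u s = ∫ s in (0 : ℝ)..t, (t - s) ^ (-γ) • g s := by
  rw [intervalIntegral.integral_of_le ht.le, intervalIntegral.integral_of_le ht.le]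
  exact setIntegral_congr_fun measurableSet_Ioc fun s hs => by rw [h s hs]

theorem Ioc_subset_Ioo_of_mem {t T : ℝ} (ht : t ∈ Ioo 0 T) {s : ℝ} (hs : s ∈ Ioc 0 t) :
    s ∈ Ioo 0 T := ⟨hs.1, hs.2.trans_lt ht.2⟩

theorem IsRegular.sub {γ T : ℝ} {u w : ℝ → H} (hu : IsRegular γ T u) (hw : IsRegular γ T w) :
    IsRegular γ T (fun t => u t - w t) := by
  refine ⟨hu.continuousOn.sub hw.continuousOn, hu.contDiffOn.sub hw.contDiffOn, fun t ht => ?_⟩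
  refine ((hu.caputoExists t ht).sub (hw.caputoExists t ht)).congr fun s hs => ?_
  rw [uIoc_of_le ht.1.le] at hs
  have hs' := Ioc_subset_Ioo_of_mem ht hs
  simp only [((hu.hasDerivAt hs').fun_sub (hw.hasDerivAt hs')).deriv, smul_sub]

theorem caputo_sub {γ T : ℝ} {u w : ℝ → H} (hu : IsRegular γ T u) (hw : IsRegular γ T w) {t : ℝ}
    (ht : t ∈ Ioo 0 T) : caputo γ (fun t => u t - w t) t = caputo γ u t - caputo γ w t := by
  rw [caputo, caputo_integrand_congr ht.1 (g := fun s => deriv u s - deriv w s) fun s hs =>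
    ((hu.hasDerivAt (Ioc_subset_Ioo_of_mem ht hs)).fun_sub
      (hw.hasDerivAt (Ioc_subset_Ioo_of_mem ht hs))).deriv]
  simp only [smul_sub]
  rw [intervalIntegral.integral_sub (hu.caputoExists t ht) (hw.caputoExists t ht), smul_sub]
  rfl

theorem IsRegular.comp_clm {γ T : ℝ} {u : ℝ → H} (hu : IsRegular γ T u)
    {G : Type*} [NormedAddCommGroup G] [InnerProductSpace ℝ G] (L : H →L[ℝ] G) :
    IsRegular γ T (fun t => L (u t)) := by
  refine ⟨L.continuous.comp_continuousOn hu.continuousOn, L.contDiff.comp_contDiffOn hu.contDiffOn,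
    fun t ht => ?_⟩
  have h : IntervalIntegrable (fun s => L ((t - s) ^ (-γ) • deriv u s)) volume 0 t :=
    ⟨L.integrable_comp (hu.caputoExists t ht).1, L.integrable_comp (hu.caputoExists t ht).2⟩
  refine h.congr fun s hs => ?_
  rw [uIoc_of_le ht.1.le] at hs
  have := (L.hasFDerivAt.comp_hasDerivAt s
    (hu.hasDerivAt (Ioc_subset_Ioo_of_mem ht hs))).deriv
  simp only [Function.comp_def] at this
  simp only [map_smul, this]

theorem caputo_comp_clm [CompleteSpace H] {γ T : ℝ} {u : ℝ → H} (hu : IsRegular γ T u)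
    {G : Type*} [NormedAddCommGroup G] [InnerProductSpace ℝ G] [CompleteSpace G] (L : H →L[ℝ] G)
    {t : ℝ} (ht : t ∈ Ioo 0 T) : caputo γ (fun t => L (u t)) t = L (caputo γ u t) := by
  rw [caputo, caputo_integrand_congr ht.1 (g := fun s => L (deriv u s)) fun s hs => ?_]
  · simp only [← map_smul]
    rw [L.intervalIntegral_comp_comm (hu.caputoExists t ht), ← map_smul]
    rfl
  · exact (L.hasFDerivAt.comp_hasDerivAt s
      (hu.hasDerivAt (Ioc_subset_Ioo_of_mem ht hs))).deriv

theorem IsRegular.const_mul {γ T : ℝ} {y : ℝ → ℝ} (hy : IsRegular γ T y) (c : ℝ) :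
    IsRegular γ T (fun t => c * y t) :=
  hy.comp_clm (c • ContinuousLinearMap.id ℝ ℝ)

theorem caputo_const_mul {γ T : ℝ} {y : ℝ → ℝ} (hy : IsRegular γ T y) (c : ℝ) {t : ℝ}
    (ht : t ∈ Ioo 0 T) : caputo γ (fun t => c * y t) t = c * caputo γ y t :=
  caputo_comp_clm hy (c • ContinuousLinearMap.id ℝ ℝ) ht

end Linear

/-! ### The extremum principle and the comparison principle -/

/-- Extremum principle for the Caputo derivative: at a minimum over `[0, t]` it is at most
`(z t - z 0) t ^ (-γ) / Γ(1 - γ)`. The function `s ↦ (t - s) ^ (-γ) (z s - z t)` extends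
continuously by zero to `s = t` since `z` is differentiable there, and its derivative dominates
the integrand because `z s ≥ z t`. -/
theorem caputo_le_of_min {γ T : ℝ} (hγ0 : 0 < γ) (hγ1 : γ < 1) {z : ℝ → ℝ}
    (hz : IsRegular γ T z) {t : ℝ} (ht : t ∈ Ioo 0 T) (hmin : ∀ s ∈ Icc 0 t, z t ≤ z s) :
    caputo γ z t ≤ (z t - z 0) * t ^ (-γ) / Real.Gamma (1 - γ) := by
  have hΓ := Real.Gamma_pos_of_pos (sub_pos.2 hγ1)
  set G : ℝ → ℝ := fun s => (t - s) ^ (-γ) * (z s - z t) with hG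
  have hGt : G t = 0 := by simp [hG]
  have hcont : ContinuousOn G (Icc 0 t) := by
    intro s hs
    rcases hs.2.lt_or_eq with hst | rfl
    · refine ContinuousWithinAt.mul ?_ ?_
      · exact ((continuousAt_const.sub continuousAt_id).rpow_const
          (Or.inl (sub_pos.2 hst).ne')).continuousWithinAt
      · exact ((hz.continuousOn s ⟨hs.1, hs.2.trans ht.2.le⟩).mono
          (Icc_subset_Icc_right ht.2.le)).sub continuousWithinAt_const
    · have hO : (fun x => z x - z s) =O[𝓝[Icc 0 s] s] fun x => x - s :=
        ((hz.hasDerivAt ht).isBigO_sub).mono nhdsWithin_le_nhds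
      have hO2 : G =O[𝓝[Icc 0 s] s] fun x => (s - x) ^ (1 - γ) := by
        have h1 := (Asymptotics.isBigO_refl (fun x => (s - x) ^ (-γ)) (𝓝[Icc 0 s] s)).mul hO
        refine h1.trans (Asymptotics.IsBigO.of_bound 1 ?_)
        filter_upwards [self_mem_nhdsWithin] with x hx
        rcases hx.2.lt_or_eq with hxs | rfl
        · have hp : 0 < s - x := sub_pos.2 hxs
          rw [one_mul, norm_mul, show x - s = -(s - x) by ring, norm_neg, ← norm_mul]
          nth_rw 2 [← Real.rpow_one (s - x)]
          rw [← Real.rpow_add hp, neg_add_eq_sub]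
        · simp
      have hlim : Tendsto (fun x => (s - x) ^ (1 - γ)) (𝓝[Icc 0 s] s) (𝓝 0) := by
        have hc : Continuous fun x : ℝ => (s - x) ^ (1 - γ) :=
          (continuous_const.sub continuous_id).rpow_const fun _ => Or.inr (by linarith)
        have := (hc.tendsto s).mono_left (nhdsWithin_le_nhds (s := Icc 0 s))
        rwa [sub_self, Real.zero_rpow (by linarith)] at this
      rw [ContinuousWithinAt, hGt]
      exact hO2.trans_tendsto hlim
  have hderiv : ∀ x ∈ Ioo 0 t, HasDerivWithinAt G
      (γ * (t - x) ^ (-γ - 1) * (z x - z t) + (t - x) ^ (-γ) * deriv z x) (Ioi x) x := by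
    intro x hx
    have h1 : HasDerivAt (fun s => (t - s) ^ (-γ)) (γ * (t - x) ^ (-γ - 1)) x := by
      have := ((hasDerivAt_id x).const_sub t).rpow_const (p := -γ) (Or.inl (sub_pos.2 hx.2).ne')
      refine this.congr_deriv ?_
      simp
    have h2 := (hz.hasDerivAt (Ioc_subset_Ioo_of_mem ht ⟨hx.1, hx.2.le⟩)).sub_const (z t)
    exact (h1.mul h2).hasDerivWithinAt
  have hint : IntegrableOn (fun s => (t - s) ^ (-γ) • deriv z s) (Icc 0 t) := by
    rw [integrableOn_Icc_iff_integrableOn_Ioc, ← intervalIntegrable_iff_integrableOn_Ioc_of_le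
      ht.1.le]
    exact hz.caputoExists t ht
  have key := intervalIntegral.integral_le_sub_of_hasDeriv_right_of_le ht.1.le hcont hderiv hint
    fun x hx => by
      have h1 : 0 ≤ z x - z t := sub_nonneg.2 (hmin x ⟨hx.1.le, hx.2.le⟩)
      have h2 : 0 < t - x := sub_pos.2 hx.2
      have : 0 ≤ γ * (t - x) ^ (-γ - 1) * (z x - z t) := by positivity
      rw [smul_eq_mul]
      linarith
  rw [hGt] at key
  simp only [hG, sub_zero, zero_sub] at key
  rw [caputo, smul_eq_mul, one_div, inv_mul_eq_div]
  gcongr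
  linarith

/-- Comparison principle: a supersolution of `∂^γ z / ∂t^γ + lam z = 0` starting from a nonnegative
value stays nonnegative. At a negative minimum the extremum principle would make both terms
negative. -/
theorem nonneg_of_caputo_add_nonneg {γ T lam : ℝ} (hγ0 : 0 < γ) (hγ1 : γ < 1) (hlam : 0 ≤ lam)
    {z : ℝ → ℝ} (hz : IsRegular γ T z) (h0 : 0 ≤ z 0)
    (h : ∀ t ∈ Ioo 0 T, 0 ≤ caputo γ z t + lam * z t) : ∀ t ∈ Ico 0 T, 0 ≤ z t := by
  intro t ht
  by_contra! hneg
  obtain ⟨m, hm, hmin⟩ := isCompact_Icc.exists_isMinOn (nonempty_Icc.2 ht.1)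
    (hz.continuousOn.mono (Icc_subset_Icc_right ht.2.le))
  have hmt : z m ≤ z t := hmin ⟨ht.1, le_rfl⟩
  have hm0 : 0 < m := by
    rcases hm.1.lt_or_eq with h' | rfl
    · exact h'
    · linarith
  have hmT : m ∈ Ioo 0 T := ⟨hm0, hm.2.trans_lt ht.2⟩
  have h1 := caputo_le_of_min hγ0 hγ1 hz hmT fun s hs => hmin ⟨hs.1, hs.2.trans hm.2⟩
  have h2 : (z m - z 0) * m ^ (-γ) / Real.Gamma (1 - γ) < 0 := by
    have := Real.Gamma_pos_of_pos (sub_pos.2 hγ1)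
    have : 0 < m ^ (-γ) := Real.rpow_pos_of_pos hm0 _
    exact div_neg_of_neg_of_pos (mul_neg_of_neg_of_pos (by linarith) this) ‹_›
  have h3 := h m hmT
  have : lam * z m ≤ 0 := mul_nonpos_of_nonneg_of_nonpos hlam (by linarith)
  linarith

/-! ### The relaxation function -/

/-- The relaxation function `x ↦ E_γ(-x)`, where `E_γ` is the Mittag-Leffler function: the solution
of `∂^γ y / ∂t^γ + lam y = 0` is `y t = E_γ(-lam t ^ γ) y 0`. -/
def relax (γ x : ℝ) : ℝ := mittagLeffler γ 1 (fun k => (-x) ^ k) 1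

theorem geomBounded_pow (c x : ℝ) : GeomBounded fun k => x ^ k * c :=
  ⟨|c|, |x|, abs_nonneg x, fun k => by rw [Real.norm_eq_abs, abs_mul, abs_pow, mul_comm]⟩

theorem mittagLeffler_mul_const (γ δ x c t : ℝ) :
    mittagLeffler γ δ (fun k => x ^ k * c) t = mittagLeffler γ δ (fun k => x ^ k) t * c := by
  simp only [mittagLeffler, smul_eq_mul]
  rw [← tsum_mul_right]
  exact tsum_congr fun k => by ring

theorem mittagLeffler_pow_eq_relax (γ lam : ℝ) {t : ℝ} (ht : 0 ≤ t) :
    mittagLeffler γ 1 (fun k => (-lam) ^ k) t = relax γ (lam * t ^ γ) := by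
  simp only [mittagLeffler, relax, smul_eq_mul]
  refine tsum_congr fun k => ?_
  rw [Real.rpow_mul ht, Real.rpow_natCast, Real.one_rpow, ← neg_mul, mul_pow]
  ring

theorem isRegular_relax {γ : ℝ} (hγ0 : 0 < γ) (hγ1 : γ < 1) (lam : ℝ) {T : ℝ} (hT : 0 < T) :
    IsRegular γ T fun t => mittagLeffler γ 1 (fun k => (-lam) ^ k) t :=
  isRegular_mittagLeffler hγ0 hγ1 hT (by simpa using geomBounded_pow 1 (-lam))

theorem caputo_relax {γ : ℝ} (hγ0 : 0 < γ) (hγ1 : γ < 1) (lam : ℝ) {t : ℝ} (ht : 0 < t) :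
    caputo γ (fun t => mittagLeffler γ 1 (fun k => (-lam) ^ k) t) t =
      -lam * mittagLeffler γ 1 (fun k => (-lam) ^ k) t := by
  rw [caputo_mittagLeffler hγ0 hγ1 (by simpa using geomBounded_pow 1 (-lam)) ht]
  simp only [pow_succ]
  rw [mittagLeffler_mul_const, mul_comm]

theorem mittagLeffler_pow_zero {γ : ℝ} (hγ0 : 0 < γ) (lam : ℝ) :
    mittagLeffler γ 1 (fun k => (-lam) ^ k) 0 = 1 := by
  rw [mittagLeffler_zero hγ0, pow_zero]

/-- The lower bound `E_γ(-x) ≥ 1 / (1 + Γ(1 - γ) x)`: it is what the equation and the extremum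
principle give at a minimum of the relaxation function. -/
theorem inv_le_relax {γ : ℝ} (hγ0 : 0 < γ) (hγ1 : γ < 1) {x : ℝ} (hx : 0 ≤ x) :
    (1 + Real.Gamma (1 - γ) * x)⁻¹ ≤ relax γ x := by
  have hΓ := Real.Gamma_pos_of_pos (sub_pos.2 hγ1)
  set y : ℝ → ℝ := fun t => mittagLeffler γ 1 (fun k => (-x) ^ k) t with hy
  have hreg := isRegular_relax hγ0 hγ1 x (two_pos (α := ℝ))
  obtain ⟨m, hm, hmin⟩ := isCompact_Icc.exists_isMinOn (nonempty_Icc.2 (zero_le_one (α := ℝ)))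
    (hreg.continuousOn.mono (Icc_subset_Icc_right one_le_two))
  have hm1 : y m ≤ y 1 := hmin ⟨zero_le_one, le_rfl⟩
  have hy0 : y 0 = 1 := mittagLeffler_pow_zero hγ0 x
  change (1 + Real.Gamma (1 - γ) * x)⁻¹ ≤ y 1
  refine le_trans ?_ hm1
  rcases hm.1.lt_or_eq with hm0 | rfl
  · have h1 := caputo_le_of_min hγ0 hγ1 hreg ⟨hm0, hm.2.trans_lt one_lt_two⟩
      fun s hs => hmin ⟨hs.1, hs.2.trans hm.2⟩
    rw [caputo_relax hγ0 hγ1 x hm0] at h1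
    change -x * y m ≤ (y m - y 0) * m ^ (-γ) / Real.Gamma (1 - γ) at h1
    rw [hy0, le_div_iff₀ hΓ, Real.rpow_neg hm0.le, ← div_eq_mul_inv,
      le_div_iff₀ (by positivity)] at h1
    have hmγ : m ^ γ ≤ 1 := Real.rpow_le_one hm0.le hm.2 hγ0.le
    have hmγ0 : 0 < m ^ γ := by positivity
    have h2 : 1 ≤ y m * (1 + x * Real.Gamma (1 - γ) * m ^ γ) := by linarith
    have hq : 0 < 1 + x * Real.Gamma (1 - γ) * m ^ γ := by positivity
    have hypos : 0 < y m := by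
      by_contra! hneg
      nlinarith [mul_nonpos_of_nonpos_of_nonneg hneg hq.le]
    rw [inv_le_iff_one_le_mul₀ (by positivity)]
    refine h2.trans (mul_le_mul_of_nonneg_left ?_ hypos.le)
    have : x * Real.Gamma (1 - γ) * m ^ γ ≤ x * Real.Gamma (1 - γ) * 1 := by gcongr
    linarith
  · rw [hy0]
    exact inv_le_one_of_one_le₀ (by nlinarith [mul_nonneg hΓ.le hx])

theorem relax_pos {γ : ℝ} (hγ0 : 0 < γ) (hγ1 : γ < 1) {x : ℝ} (hx : 0 ≤ x) : 0 < relax γ x := by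
  have hΓ := Real.Gamma_pos_of_pos (sub_pos.2 hγ1)
  exact lt_of_lt_of_le (by positivity) (inv_le_relax hγ0 hγ1 hx)

theorem relax_antitone {γ : ℝ} (hγ0 : 0 < γ) (hγ1 : γ < 1) {x y : ℝ} (hx : 0 ≤ x) (hxy : x ≤ y) :
    relax γ y ≤ relax γ x := by
  have hrx := isRegular_relax hγ0 hγ1 x (two_pos (α := ℝ))
  have hry := isRegular_relax hγ0 hγ1 y (two_pos (α := ℝ))
  have := nonneg_of_caputo_add_nonneg (lam := y) hγ0 hγ1 (hx.trans hxy) (hrx.sub hry)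
    (by simp [mittagLeffler_pow_zero hγ0]) (fun t ht => ?_) 1 ⟨zero_le_one, one_lt_two⟩
  · exact sub_nonneg.1 this
  · rw [caputo_sub hrx hry ht, caputo_relax hγ0 hγ1 x ht.1, caputo_relax hγ0 hγ1 y ht.1,
      mittagLeffler_pow_eq_relax γ x ht.1.le, mittagLeffler_pow_eq_relax γ y ht.1.le]
    have h1 : 0 < relax γ (x * t ^ γ) :=
      relax_pos hγ0 hγ1 (mul_nonneg hx (Real.rpow_nonneg ht.1.le _))
    nlinarith [mul_nonneg (sub_nonneg.2 hxy) h1.le]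

theorem relax_zero {γ : ℝ} : relax γ 0 = 1 := by
  rw [relax, mittagLeffler, tsum_eq_single 0]
  · simp
  · intro k hk
    simp [hk]

theorem relax_le_one {γ : ℝ} (hγ0 : 0 < γ) (hγ1 : γ < 1) {x : ℝ} (hx : 0 ≤ x) : relax γ x ≤ 1 :=
  (relax_antitone hγ0 hγ1 le_rfl hx).trans_eq relax_zero

/-- The upper bound `E_γ(-x) ≤ 1 / (1 + x / Γ(1 + γ))`, from the Volterra equation
`y = 1 - x J^γ y` and the monotonicity of `y`. -/
theorem relax_le_inv {γ : ℝ} (hγ0 : 0 < γ) (hγ1 : γ < 1) {x : ℝ} (hx : 0 ≤ x) :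
    relax γ x ≤ (1 + x / Real.Gamma (γ + 1))⁻¹ := by
  have ha : GeomBounded fun k => (-x) ^ k := by simpa using geomBounded_pow 1 (-x)
  have h1 := integral_mittagLeffler hγ0 one_pos hγ0 ha one_pos
  have h2 := mittagLeffler_one_eq hγ0 ha one_pos
  have hint := intervalIntegrable_mittagLeffler hγ0 one_pos hγ0 ha one_pos
  simp only [pow_succ] at h2
  rw [mittagLeffler_mul_const] at h2
  simp only [sub_self, Real.rpow_zero, Real.one_rpow, add_comm 1 γ, smul_eq_mul, pow_zero,
    one_mul] at h1 h2 hint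
  have hΓ := Real.Gamma_pos_of_pos hγ0
  have hk : ∫ s in (0 : ℝ)..1, (1 - s) ^ (γ - 1) * relax γ x = 1 / γ * relax γ x := by
    have := integral_sub_rpow_mul_rpow hγ0 one_pos one_pos
    simp only [sub_self, Real.rpow_zero, mul_one, Real.one_rpow, one_mul, Real.Gamma_one,
      add_comm 1 γ, Real.Gamma_add_one hγ0.ne'] at this
    rw [intervalIntegral.integral_mul_const, this]
    field_simp
  have hi0 := intervalIntegrable_sub_rpow_mul_rpow hγ0 one_pos one_pos
  simp only [sub_self, Real.rpow_zero, mul_one] at hi0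
  have hle : 1 / γ * relax γ x ≤ ∫ s in (0 : ℝ)..1, (1 - s) ^ (γ - 1) *
      mittagLeffler γ 1 (fun k => (-x) ^ k) s := by
    rw [← hk]
    refine intervalIntegral.integral_mono_on zero_le_one (hi0.mul_const _) hint fun s hs => ?_
    rw [mittagLeffler_pow_eq_relax γ x hs.1]
    refine mul_le_mul_of_nonneg_left (relax_antitone hγ0 hγ1 ?_ ?_)
      (Real.rpow_nonneg (by linarith [hs.2]) _)
    · exact mul_nonneg hx (Real.rpow_nonneg hs.1 _)
    · exact mul_le_of_le_one_right hx (Real.rpow_le_one hs.1 hs.2 hγ0.le)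
  rw [h1] at hle
  change relax γ x = _ at h2
  have h3 : x * relax γ x ≤ (1 - relax γ x) * Real.Gamma (γ + 1) := by
    rw [Real.Gamma_add_one hγ0.ne'] at *
    have := mul_le_mul_of_nonneg_left hle (mul_nonneg hx hγ0.le)
    have e1 : x * γ * (1 / γ * relax γ x) = x * relax γ x := by field_simp
    rw [e1] at this
    refine this.trans_eq ?_
    rw [h2]
    ring
  have hΓ1 : 0 < Real.Gamma (γ + 1) := Real.Gamma_pos_of_pos (by positivity)
  rw [le_inv_comm₀ (relax_pos hγ0 hγ1 hx) (by positivity), ← one_div,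
    le_div_iff₀ (relax_pos hγ0 hγ1 hx)]
  have : x / Real.Gamma (γ + 1) * relax γ x ≤ 1 - relax γ x := by
    rw [div_mul_eq_mul_div, div_le_iff₀ hΓ1]
    exact h3
  linarith

/-- The doubling constant of the relaxation function. -/
def relaxConst (γ : ℝ) : ℝ := 1 + 2 * Real.Gamma (1 - γ) * Real.Gamma (γ + 1)

theorem relaxConst_pos {γ : ℝ} (hγ0 : 0 < γ) (hγ1 : γ < 1) : 0 < relaxConst γ := by
  have := Real.Gamma_pos_of_pos (sub_pos.2 hγ1)
  have : 0 < Real.Gamma (γ + 1) := Real.Gamma_pos_of_pos (by positivity)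
  unfold relaxConst
  positivity

theorem relax_half_le {γ : ℝ} (hγ0 : 0 < γ) (hγ1 : γ < 1) {x : ℝ} (hx : 0 ≤ x) :
    relax γ (x / 2) ≤ relaxConst γ * relax γ x := by
  have h1 := Real.Gamma_pos_of_pos (sub_pos.2 hγ1)
  have h2 : 0 < Real.Gamma (γ + 1) := Real.Gamma_pos_of_pos (by positivity)
  refine (relax_le_inv hγ0 hγ1 (by positivity)).trans (le_trans ?_
    (mul_le_mul_of_nonneg_left (inv_le_relax hγ0 hγ1 hx) (relaxConst_pos hγ0 hγ1).le))
  rw [← div_eq_mul_inv, le_div_iff₀ (by positivity), inv_mul_le_iff₀ (by positivity), relaxConst]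
  have e : (1 + x / 2 / Real.Gamma (γ + 1)) * (1 + 2 * Real.Gamma (1 - γ) * Real.Gamma (γ + 1)) =
      1 + Real.Gamma (1 - γ) * x + 2 * Real.Gamma (1 - γ) * Real.Gamma (γ + 1) +
        x / 2 / Real.Gamma (γ + 1) := by
    field_simp
    ring
  rw [e]
  have : 0 < 2 * Real.Gamma (1 - γ) * Real.Gamma (γ + 1) := by positivity
  have : 0 ≤ x / 2 / Real.Gamma (γ + 1) := by positivity
  linarith

/-- Relative variation of the relaxation function. For `μ ≤ lam` the difference of the two
relaxation functions solves the equation for `lam` with source `(lam - μ) y_μ`, and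
`2 (1 - μ / lam) y_{μ/2}` is a supersolution for it. -/
theorem relax_sub_le {γ : ℝ} (hγ0 : 0 < γ) (hγ1 : γ < 1) {μ lam : ℝ} (hμ : 0 < μ)
    (h : μ ≤ lam) : relax γ μ - relax γ lam ≤ 2 * relaxConst γ * (1 - μ / lam) * relax γ μ := by
  have hlam : 0 < lam := hμ.trans_le h
  have hr1 : μ / lam ≤ 1 := (div_le_one hlam).2 h
  have hl := isRegular_relax hγ0 hγ1 lam (two_pos (α := ℝ))
  have hm := isRegular_relax hγ0 hγ1 μ (two_pos (α := ℝ))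
  have hh := isRegular_relax hγ0 hγ1 (μ / 2) (two_pos (α := ℝ))
  set c := 2 * (1 - μ / lam) with hc
  have key := nonneg_of_caputo_add_nonneg (lam := lam) hγ0 hγ1 hlam.le
    ((hh.const_mul c).sub (hm.sub hl)) ?_ (fun t ht => ?_) 1 ⟨zero_le_one, one_lt_two⟩
  · change 0 ≤ c * relax γ (μ / 2) - (relax γ μ - relax γ lam) at key
    have := mul_le_mul_of_nonneg_left (relax_half_le hγ0 hγ1 hμ.le)
      (show 0 ≤ c by rw [hc]; linarith)
    rw [hc] at *
    linarith
  · simp only [mittagLeffler_pow_zero hγ0, hc]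
    linarith
  · rw [caputo_sub (hh.const_mul c) (hm.sub hl) ht, caputo_sub hm hl ht, caputo_const_mul hh c ht,
      caputo_relax hγ0 hγ1 lam ht.1, caputo_relax hγ0 hγ1 μ ht.1, caputo_relax hγ0 hγ1 _ ht.1,
      mittagLeffler_pow_eq_relax γ lam ht.1.le, mittagLeffler_pow_eq_relax γ μ ht.1.le,
      mittagLeffler_pow_eq_relax γ (μ / 2) ht.1.le]
    have ht0 : 0 < t ^ γ := Real.rpow_pos_of_pos ht.1 _
    have hmono : relax γ (μ * t ^ γ) ≤ relax γ (μ / 2 * t ^ γ) :=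
      relax_antitone hγ0 hγ1 (by positivity) (by gcongr; linarith)
    have hp : 0 ≤ relax γ (μ / 2 * t ^ γ) := (relax_pos hγ0 hγ1 (by positivity)).le
    set P := relax γ (μ / 2 * t ^ γ)
    set Q := relax γ (μ * t ^ γ)
    set S := relax γ (lam * t ^ γ)
    have e : c * (-(μ / 2) * P) - (-μ * Q - -lam * S) + lam * (c * P - (Q - S)) =
        (lam - μ) * ((1 - μ / lam) * P + (P - Q)) := by
      rw [hc]
      field_simp
      ring
    rw [e]
    exact mul_nonneg (sub_nonneg.2 h)
      (add_nonneg (mul_nonneg (sub_nonneg.2 hr1) hp) (sub_nonneg.2 hmono))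

/-- Scalar solutions are multiples of the relaxation function. -/
theorem eq_mul_relax {γ T lam : ℝ} (hγ0 : 0 < γ) (hγ1 : γ < 1) (hT : 0 < T) (hlam : 0 ≤ lam)
    {y : ℝ → ℝ} (hy : IsRegular γ T y) (h : ∀ t ∈ Ioo 0 T, caputo γ y t + lam * y t = 0) :
    ∀ t ∈ Icc 0 T, y t = y 0 * relax γ (lam * t ^ γ) := by
  have hr := (isRegular_relax hγ0 hγ1 lam hT).const_mul (y 0)
  have heq : ∀ t ∈ Ioo 0 T, caputo γ (fun t => y t -
      y 0 * mittagLeffler γ 1 (fun k => (-lam) ^ k) t) t + lam * (y t -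
      y 0 * mittagLeffler γ 1 (fun k => (-lam) ^ k) t) = 0 := by
    intro t ht
    rw [caputo_sub hy hr ht, caputo_const_mul (isRegular_relax hγ0 hγ1 lam hT) _ ht,
      caputo_relax hγ0 hγ1 lam ht.1]
    linarith [h t ht]
  have heq' : ∀ t ∈ Ioo 0 T, caputo γ (fun t =>
      y 0 * mittagLeffler γ 1 (fun k => (-lam) ^ k) t - y t) t + lam * (
      y 0 * mittagLeffler γ 1 (fun k => (-lam) ^ k) t - y t) = 0 := by
    intro t ht
    rw [caputo_sub hr hy ht, caputo_const_mul (isRegular_relax hγ0 hγ1 lam hT) _ ht,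
      caputo_relax hγ0 hγ1 lam ht.1]
    linarith [h t ht]
  have h1 := nonneg_of_caputo_add_nonneg hγ0 hγ1 hlam (hy.sub hr)
    (by simp [mittagLeffler_pow_zero hγ0]) fun t ht => (heq t ht).ge
  have h2 := nonneg_of_caputo_add_nonneg hγ0 hγ1 hlam (hr.sub hy)
    (by simp [mittagLeffler_pow_zero hγ0]) fun t ht => (heq' t ht).ge
  have h3 : EqOn y (fun t => y 0 * mittagLeffler γ 1 (fun k => (-lam) ^ k) t) (Ico 0 T) :=
    fun t ht => le_antisymm (sub_nonneg.1 (h2 t ht)) (sub_nonneg.1 (h1 t ht))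
  have h4 := h3.of_subset_closure hy.continuousOn hr.continuousOn Ico_subset_Icc_self
    (by rw [closure_Ico hT.ne])
  intro t ht
  refine (h4 ht).trans ?_
  simp only
  rw [mittagLeffler_pow_eq_relax γ lam ht.1]

/-! ### Diagonal estimates in the eigenbasis -/

section Hilbert

variable {H : Type*} [NormedAddCommGroup H] [InnerProductSpace ℝ H]

theorem exists_inner_eq_of_le (φ : HilbertBasis ℕ ℝ H) {c : ℕ → ℝ} {K : ℝ} (hK : 0 ≤ K) {y : H}
    (h : ∀ n, |c n| ≤ K * |inner ℝ y (φ n)|) :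
    ∃ x : H, (∀ n, inner ℝ x (φ n) = c n) ∧ ‖x‖ ≤ K * ‖y‖ := by
  have hle : ∀ n, c n ^ 2 ≤ K ^ 2 * inner ℝ y (φ n) ^ 2 := fun n => by
    rw [← mul_pow, sq_le_sq, abs_mul, abs_of_nonneg hK]
    exact h n
  have hy := summable_inner_sq φ y
  have hc : Summable fun n => c n ^ 2 :=
    Summable.of_nonneg_of_le (fun _ => sq_nonneg _) hle (hy.summable.mul_left _)
  obtain ⟨h1, h2⟩ := diag_aux φ c hc
  refine ⟨_, h1, le_of_sq_le_sq ?_ (by positivity)⟩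
  rw [h2, mul_pow, ← hy.tsum_eq, ← tsum_mul_left]
  exact hc.tsum_le_tsum hle (hy.summable.mul_left _)

theorem norm_le_of_inner_le (φ : HilbertBasis ℕ ℝ H) {x y : H} {K : ℝ} (hK : 0 ≤ K)
    (h : ∀ n, |inner ℝ x (φ n)| ≤ K * |inner ℝ y (φ n)|) : ‖x‖ ≤ K * ‖y‖ := by
  obtain ⟨x', h1, h2⟩ := exists_inner_eq_of_le φ hK h
  rwa [ext_inner φ h1] at h2

theorem exists_inner_eq_rpow_mul (φ : HilbertBasis ℕ ℝ H) {lam : ℕ → ℝ} (hlam : ∀ n, 0 < lam n)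
    {p : ℝ} {ψ : H} (hψ : ψ ∈ powDomain φ lam p) :
    ∃ χ : H, (∀ n, inner ℝ χ (φ n) = lam n ^ p * inner ℝ ψ (φ n)) ∧
      ‖χ‖ = powNorm φ lam p ψ := by
  have e : ∀ n, lam n ^ (2 * p) * inner ℝ ψ (φ n) ^ 2 = (lam n ^ p * inner ℝ ψ (φ n)) ^ 2 := by
    intro n
    rw [mul_pow, mul_comm 2 p, Real.rpow_mul (hlam n).le]
    norm_cast
  have hs : Summable fun n => (lam n ^ p * inner ℝ ψ (φ n)) ^ 2 :=
    (show Summable _ from hψ).congr e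
  obtain ⟨h1, h2⟩ := diag_aux φ _ hs
  refine ⟨_, h1, ?_⟩
  rw [powNorm, tsum_congr e, ← h2, Real.sqrt_sq (norm_nonneg _)]

theorem inner_regOp (φ : HilbertBasis ℕ ℝ H) {lam : ℕ → ℝ} (hlam : ∀ n, 0 < lam n) {α b : ℝ}
    (hα : 0 < α) (hb : 1 ≤ b) (v : H) (n : ℕ) :
    inner ℝ (regOp φ lam α b v) (φ n) = lam n / (1 + α * lam n ^ b) * inner ℝ v (φ n) :=
  (diag_aux φ _ (summable_symbol φ hlam hα hb v)).1 n

/-! ### Solutions in the eigenbasis -/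

variable [CompleteSpace H]

/-- If the coefficients of `∂^γ u / ∂t^γ` are `-lam` times those of `u`, then the coefficients of
`u` are relaxation functions. -/
theorem inner_eq_mul_relax {γ T lam : ℝ} (hγ0 : 0 < γ) (hγ1 : γ < 1) (hT : 0 < T)
    (hlam : 0 ≤ lam) {u : ℝ → H} (hu : IsRegular γ T u) (e : H)
    (h : ∀ t ∈ Ioo 0 T, inner ℝ (caputo γ u t) e + lam * inner ℝ (u t) e = 0) :
    ∀ t ∈ Icc 0 T, inner ℝ (u t) e = inner ℝ (u 0) e * relax γ (lam * t ^ γ) := by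
  have hr := hu.comp_clm (innerSL ℝ e)
  have := eq_mul_relax hγ0 hγ1 hT hlam hr fun t ht => ?_
  · simpa only [innerSL_apply_apply, real_inner_comm] using this
  · rw [caputo_comp_clm hu (innerSL ℝ e) ht]
    simpa only [innerSL_apply_apply, real_inner_comm] using h t ht

theorem inner_parabolic {A : H →ₗ.[ℝ] H} (hA : IsSelfAdjoint A) {lam : ℝ} (hlam : 0 ≤ lam)
    {e : H} (he : ∃ h : e ∈ A.domain, A ⟨e, h⟩ = lam • e) {γ T : ℝ} (hγ0 : 0 < γ) (hγ1 : γ < 1)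
    (hT : 0 < T) {u : ℝ → H} (hu : IsParabolicSolution A γ T u) :
    ∀ t ∈ Icc 0 T, inner ℝ (u t) e = inner ℝ (u 0) e * relax γ (lam * t ^ γ) := by
  refine inner_eq_mul_relax hγ0 hγ1 hT hlam hu.regular e fun t ht => ?_
  obtain ⟨hdom, heq⟩ := hu.equation t ht
  obtain ⟨hed, hee⟩ := he
  have hf := LinearPMap.adjoint_isFormalAdjoint hA.dense_domain
  rw [LinearPMap.isSelfAdjoint_def.1 hA] at hf
  have h1 : inner ℝ (A ⟨u t, hdom⟩) e = lam * inner ℝ (u t) e := by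
    rw [hf ⟨u t, hdom⟩ ⟨e, hed⟩, hee, inner_smul_right]
  rw [← h1, ← inner_add_left, heq, inner_zero_left]

theorem inner_regularized {φ : HilbertBasis ℕ ℝ H} {lam : ℕ → ℝ} (hlam : ∀ n, 0 < lam n)
    {γ T α b : ℝ} (hγ0 : 0 < γ) (hγ1 : γ < 1) (hT : 0 < T) (hα : 0 < α) (hb : 1 ≤ b) {f : H}
    {v : ℝ → H} (hv : IsRegularizedSolution φ lam γ T α b f v) (n : ℕ) :
    ∀ t ∈ Icc 0 T, inner ℝ (v t) (φ n) =
      inner ℝ (v 0) (φ n) * relax γ (lam n / (1 + α * lam n ^ b) * t ^ γ) := by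
  refine inner_eq_mul_relax hγ0 hγ1 hT (symbol_le hlam hα hb n).1 hv.regular _ fun t ht => ?_
  rw [← inner_regOp φ hlam hα hb, ← inner_add_left, hv.equation t ht, inner_zero_left]

theorem div_relax_le {γ : ℝ} (hγ0 : 0 < γ) (hγ1 : γ < 1) {x : ℝ} (hx : 0 ≤ x) :
    1 / relax γ x ≤ 1 + Real.Gamma (1 - γ) * x := by
  have := Real.Gamma_pos_of_pos (sub_pos.2 hγ1)
  rw [one_div]
  exact inv_le_of_inv_le₀ (by positivity) (inv_le_relax hγ0 hγ1 hx)

theorem abs_div_relax_le {γ : ℝ} (hγ0 : 0 < γ) (hγ1 : γ < 1) {x N : ℝ} (hx : 0 ≤ x)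
    (hN : 1 + Real.Gamma (1 - γ) * x ≤ N) (c : ℝ) : |c / relax γ x| ≤ N * |c| := by
  rw [abs_div, abs_of_pos (relax_pos hγ0 hγ1 hx), div_eq_mul_one_div, mul_comm]
  exact mul_le_mul_of_nonneg_right ((div_relax_le hγ0 hγ1 hx).trans hN) (abs_nonneg _)

/-! ### Well-posedness of the regularized problem -/

/-- The stability constant of the regularized problem. -/
def stabilityConst (γ T α : ℝ) : ℝ := 1 + Real.Gamma (1 - γ) * ((1 + 1 / α) * T ^ γ)

theorem symbol_mul_le_stabilityConst {lam : ℕ → ℝ} (hlam : ∀ n, 0 < lam n) {γ T α b : ℝ}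
    (hγ1 : γ < 1) (hT : 0 < T) (hα : 0 < α) (hb : 1 ≤ b) (n : ℕ) :
    1 + Real.Gamma (1 - γ) * (lam n / (1 + α * lam n ^ b) * T ^ γ) ≤ stabilityConst γ T α := by
  have := Real.Gamma_pos_of_pos (sub_pos.2 hγ1)
  unfold stabilityConst
  gcongr
  exact (symbol_le hlam hα hb n).2

theorem stabilityConst_pos {γ T α : ℝ} (hγ1 : γ < 1) (hT : 0 < T) (hα : 0 < α) :
    0 < stabilityConst γ T α := by
  have := Real.Gamma_pos_of_pos (sub_pos.2 hγ1)
  unfold stabilityConst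
  positivity

theorem norm_sub_le_of_regularized {φ : HilbertBasis ℕ ℝ H} {lam : ℕ → ℝ} (hlam : ∀ n, 0 < lam n)
    {γ T α b : ℝ} (hγ0 : 0 < γ) (hγ1 : γ < 1) (hT : 0 < T) (hα : 0 < α) (hb : 1 ≤ b) {f g : H}
    {v w : ℝ → H} (hv : IsRegularizedSolution φ lam γ T α b f v)
    (hw : IsRegularizedSolution φ lam γ T α b g w) {t : ℝ} (ht : t ∈ Icc 0 T) :
    ‖v t - w t‖ ≤ stabilityConst γ T α * ‖f - g‖ := by
  refine norm_le_of_inner_le φ (stabilityConst_pos hγ1 hT hα).le fun n => ?_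
  have hμ := (symbol_le hlam hα hb n).1
  have hTm : T ∈ Icc 0 T := ⟨hT.le, le_rfl⟩
  have hμT := mul_nonneg hμ (Real.rpow_nonneg hT.le γ)
  have hμt := mul_nonneg hμ (Real.rpow_nonneg ht.1 γ)
  have hr := relax_pos hγ0 hγ1 hμT
  have h0 : inner ℝ (v 0 - w 0) (φ n) = inner ℝ (f - g) (φ n) /
      relax γ (lam n / (1 + α * lam n ^ b) * T ^ γ) := by
    rw [eq_div_iff hr.ne', ← hv.final, ← hw.final, inner_sub_left, inner_sub_left, sub_mul,
      ← inner_regularized hlam hγ0 hγ1 hT hα hb hv n T hTm,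
      ← inner_regularized hlam hγ0 hγ1 hT hα hb hw n T hTm]
  have h1 : inner ℝ (v t - w t) (φ n) =
      inner ℝ (v 0 - w 0) (φ n) * relax γ (lam n / (1 + α * lam n ^ b) * t ^ γ) := by
    rw [inner_sub_left, inner_sub_left, sub_mul,
      ← inner_regularized hlam hγ0 hγ1 hT hα hb hv n t ht,
      ← inner_regularized hlam hγ0 hγ1 hT hα hb hw n t ht]
  rw [h1, abs_mul, abs_of_pos (relax_pos hγ0 hγ1 hμt)]
  refine (mul_le_of_le_one_right (abs_nonneg _) (relax_le_one hγ0 hγ1 hμt)).trans ?_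
  rw [h0]
  exact abs_div_relax_le hγ0 hγ1 hμT (symbol_mul_le_stabilityConst hlam hγ1 hT hα hb n) _

theorem inner_mittagLeffler {γ δ : ℝ} (hγ : 0 < γ) (hδ : 0 < δ) {a : ℕ → H} (ha : GeomBounded a)
    {t : ℝ} (ht : 0 ≤ t) (e : H) : inner ℝ (mittagLeffler γ δ a t) e =
      mittagLeffler γ δ (fun k => inner ℝ (a k) e) t := by
  rw [real_inner_comm, ← innerSL_apply_apply ℝ, mittagLeffler,
    (innerSL ℝ e).map_tsum (summable_mittagLeffler hγ hδ ha ht), mittagLeffler]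
  refine tsum_congr fun k => ?_
  rw [map_smul, innerSL_apply_apply, real_inner_comm]

/-- The solution is the Mittag-Leffler series with coefficients `(-A_α) ^ k v₀`, where `v₀` has the
coefficients of `f` divided by the relaxation functions at time `T`. -/
theorem exists_regularized (φ : HilbertBasis ℕ ℝ H) {lam : ℕ → ℝ} (hlam : ∀ n, 0 < lam n)
    {γ T α b : ℝ} (hγ0 : 0 < γ) (hγ1 : γ < 1) (hT : 0 < T) (hα : 0 < α) (hb : 1 ≤ b) (f : H) :
    ∃ v, IsRegularizedSolution φ lam γ T α b f v := by
  set μ : ℕ → ℝ := fun n => lam n / (1 + α * lam n ^ b) with hμdef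
  have hμ : ∀ n, 0 ≤ μ n := fun n => (symbol_le hlam hα hb n).1
  have hμ1 : ∀ n, μ n ≤ 1 + 1 / α := fun n => (symbol_le hlam hα hb n).2
  have hμT : ∀ n, 0 ≤ μ n * T ^ γ := fun n => mul_nonneg (hμ n) (Real.rpow_nonneg hT.le γ)
  obtain ⟨v₀, hv₀, -⟩ := exists_inner_eq_of_le φ (stabilityConst_pos hγ1 hT hα).le
    (y := f) (c := fun n => inner ℝ f (φ n) / relax γ (μ n * T ^ γ)) fun n =>
      abs_div_relax_le hγ0 hγ1 (hμT n) (symbol_mul_le_stabilityConst hlam hγ1 hT hα hb n) _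
  have hex : ∀ k : ℕ, ∃ x : H, (∀ n, inner ℝ x (φ n) = (-μ n) ^ k * inner ℝ v₀ (φ n)) ∧
      ‖x‖ ≤ (1 + 1 / α) ^ k * ‖v₀‖ := fun k => by
    refine exists_inner_eq_of_le φ (by positivity) fun n => ?_
    rw [abs_mul, abs_pow, abs_neg, abs_of_nonneg (hμ n)]
    have := hμ n
    have := hμ1 n
    gcongr
  choose a ha hnorm using hex
  have hgeom : GeomBounded a :=
    ⟨‖v₀‖, 1 + 1 / α, by positivity, fun k => (hnorm k).trans_eq (mul_comm _ _)⟩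
  refine ⟨mittagLeffler γ 1 a, isRegular_mittagLeffler hγ0 hγ1 hT hgeom, fun t ht => ?_, ?_⟩
  · refine ext_inner φ fun n => ?_
    rw [inner_add_left, inner_regOp φ hlam hα hb, caputo_mittagLeffler hγ0 hγ1 hgeom ht.1,
      inner_mittagLeffler hγ0 one_pos hgeom.shift ht.1.le,
      inner_mittagLeffler hγ0 one_pos hgeom ht.1.le, inner_zero_left]
    simp only [ha, pow_succ, mul_assoc]
    rw [mittagLeffler_mul_const, mittagLeffler_mul_const]
    ring
  · refine ext_inner φ fun n => ?_
    rw [inner_mittagLeffler hγ0 one_pos hgeom hT.le]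
    simp only [ha]
    rw [mittagLeffler_mul_const, mittagLeffler_pow_eq_relax γ (μ n) hT.le, hv₀,
      mul_div_cancel₀ _ (relax_pos hγ0 hγ1 (hμT n)).ne']

theorem isWellPosed (φ : HilbertBasis ℕ ℝ H) {lam : ℕ → ℝ} (hlam : ∀ n, 0 < lam n)
    {γ T α b : ℝ} (hγ0 : 0 < γ) (hγ1 : γ < 1) (hT : 0 < T) (hα : 0 < α) (hb : 1 ≤ b) :
    IsWellPosed φ lam γ T α b := by
  refine ⟨exists_regularized φ hlam hγ0 hγ1 hT hα hb, fun f v w hv hw t ht => ?_,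
    stabilityConst γ T α, fun f g v w hv hw t ht =>
      norm_sub_le_of_regularized hlam hγ0 hγ1 hT hα hb hv hw ht⟩
  have := norm_sub_le_of_regularized hlam hγ0 hγ1 hT hα hb hv hw ht
  rw [sub_self, norm_zero, mul_zero] at this
  exact sub_eq_zero.1 (norm_le_zero_iff.1 this)

/-! ### The error estimate -/

/-- The data error is amplified by the inverse relaxation functions of the regularized problem,
and the regularization error is controlled by `relax_sub_le` and the smoothness of `u 0`. -/
theorem norm_initial_sub_le {A : H →ₗ.[ℝ] H} (hA : IsSelfAdjoint A) {φ : HilbertBasis ℕ ℝ H}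
    {lam : ℕ → ℝ} (hφ : ∀ n, ∃ h : φ n ∈ A.domain, A ⟨φ n, h⟩ = lam n • φ n)
    (hlam : ∀ n, 0 < lam n) {γ T α b p N D : ℝ} (hγ0 : 0 < γ) (hγ1 : γ < 1) (hT : 0 < T)
    (hα : 0 < α) (hb : 1 ≤ b) (hN0 : 0 ≤ N) (hD0 : 0 ≤ D)
    (hN : ∀ n, 1 + Real.Gamma (1 - γ) * (lam n / (1 + α * lam n ^ b) * T ^ γ) ≤ N)
    (hD : ∀ n, α * lam n ^ b / (1 + α * lam n ^ b) ≤ D * lam n ^ p) {f : H} {u v : ℝ → H}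
    (hu : IsParabolicSolution A γ T u) (hu0 : u 0 ∈ powDomain φ lam p)
    (hv : IsRegularizedSolution φ lam γ T α b f v) :
    ‖u 0 - v 0‖ ≤ N * ‖u T - f‖ + 2 * relaxConst γ * D * powNorm φ lam p (u 0) := by
  set μ : ℕ → ℝ := fun n => lam n / (1 + α * lam n ^ b) with hμdef
  have hTγ : 0 < T ^ γ := Real.rpow_pos_of_pos hT γ
  have hden : ∀ n, 0 < 1 + α * lam n ^ b := fun n => by
    have := Real.rpow_pos_of_pos (hlam n) b
    positivity
  have hμ : ∀ n, 0 < μ n := fun n => div_pos (hlam n) (hden n)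
  have hr : ∀ n, 0 < relax γ (μ n * T ^ γ) := fun n =>
    relax_pos hγ0 hγ1 (mul_pos (hμ n) hTγ).le
  have hTm : T ∈ Icc 0 T := ⟨hT.le, le_rfl⟩
  obtain ⟨χ, hχ, hχn⟩ := exists_inner_eq_rpow_mul φ hlam hu0
  obtain ⟨x, hx, hxn⟩ := exists_inner_eq_of_le φ hN0 (y := u T - f)
    (c := fun n => inner ℝ (u T - f) (φ n) / relax γ (μ n * T ^ γ)) fun n =>
      abs_div_relax_le hγ0 hγ1 (mul_pos (hμ n) hTγ).le (hN n) _
  have hC := relaxConst_pos hγ0 hγ1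
  have hy : ‖u 0 - v 0 - x‖ ≤ 2 * relaxConst γ * D * ‖χ‖ := by
    refine norm_le_of_inner_le φ (by positivity) fun n => ?_
    have hle : μ n ≤ lam n := div_le_self (hlam n).le (by
      have := Real.rpow_pos_of_pos (hlam n) b
      nlinarith)
    have hleT : μ n * T ^ γ ≤ lam n * T ^ γ := by gcongr
    have e : inner ℝ (u 0 - v 0 - x) (φ n) = inner ℝ (u 0) (φ n) *
        ((relax γ (μ n * T ^ γ) - relax γ (lam n * T ^ γ)) / relax γ (μ n * T ^ γ)) := by
      have hrn := (hr n).ne'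
      have h1 := inner_parabolic hA (hlam n).le (hφ n) hγ0 hγ1 hT hu T hTm
      have h2 := inner_regularized hlam hγ0 hγ1 hT hα hb hv n T hTm
      rw [hv.final] at h2
      rw [inner_sub_left, inner_sub_left, hx, inner_sub_left, h1, h2]
      change _ - _ - (_ - _ * relax γ (μ n * T ^ γ)) / _ = _
      rw [mul_div_assoc', eq_div_iff hrn, sub_mul, div_mul_cancel₀ _ hrn]
      ring
    have hdiff : 0 ≤ relax γ (μ n * T ^ γ) - relax γ (lam n * T ^ γ) :=
      sub_nonneg.2 (relax_antitone hγ0 hγ1 (mul_pos (hμ n) hTγ).le hleT)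
    have hratio : 1 - μ n * T ^ γ / (lam n * T ^ γ) =
        α * lam n ^ b / (1 + α * lam n ^ b) := by
      have := (hlam n).ne'
      have := (hden n).ne'
      simp only [hμdef]
      field_simp
      ring
    have hsub := relax_sub_le hγ0 hγ1 (mul_pos (hμ n) hTγ) hleT
    rw [hratio] at hsub
    rw [e, hχ, abs_mul, abs_mul, abs_of_nonneg (div_nonneg hdiff (hr n).le),
      abs_of_pos (Real.rpow_pos_of_pos (hlam n) p), mul_comm]
    have h3 : (relax γ (μ n * T ^ γ) - relax γ (lam n * T ^ γ)) / relax γ (μ n * T ^ γ) ≤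
        2 * relaxConst γ * (D * lam n ^ p) :=
      ((div_le_iff₀ (hr n)).2 hsub).trans (mul_le_mul_of_nonneg_left (hD n) (by positivity))
    refine (mul_le_mul_of_nonneg_right h3 (abs_nonneg _)).trans_eq ?_
    ring
  rw [hχn] at hy
  calc ‖u 0 - v 0‖ = ‖x + (u 0 - v 0 - x)‖ := by congr 1; abel
    _ ≤ ‖x‖ + ‖u 0 - v 0 - x‖ := norm_add_le _ _
    _ ≤ _ := add_le_add hxn hy

theorem symbol_le_rpow {l α b : ℝ} (hl : 0 < l) (hα : 0 < α) (hb : 1 ≤ b) :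
    l / (1 + α * l ^ b) ≤ α ^ (-(1 / b)) := by
  have hb0 : 0 < b := by linarith
  set x := α ^ (1 / b) * l with hx
  have hαb : 0 < α ^ (1 / b) := by positivity
  have hx0 : 0 < x := by positivity
  have hxb : α * l ^ b = x ^ b := by
    rw [hx, Real.mul_rpow hαb.le hl.le, ← Real.rpow_mul hα.le, one_div_mul_cancel hb0.ne',
      Real.rpow_one]
  have hle : x ≤ 1 + x ^ b := by
    have : 0 < x ^ b := by positivity
    rcases le_total x 1 with h | h
    · linarith
    · have := Real.rpow_le_rpow_of_exponent_le h hb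
      rw [Real.rpow_one] at this
      linarith
  rw [hxb, Real.rpow_neg hα.le, div_le_iff₀ (by positivity), inv_mul_eq_div, le_div_iff₀ hαb,
    mul_comm]
  exact hle

theorem filter_le_rpow {l α b p : ℝ} (hl : 0 < l) (hα : 0 < α) (hp : 0 < p) (hpb : p ≤ b) :
    α * l ^ b / (1 + α * l ^ b) ≤ α ^ (p / b) * l ^ p := by
  have hb0 : 0 < b := hp.trans_le hpb
  set x := α ^ (1 / b) * l with hx
  have hαb : 0 < α ^ (1 / b) := by positivity
  have hx0 : 0 < x := by positivity
  have hxb : ∀ q, x ^ q = α ^ (q / b) * l ^ q := fun q => by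
    rw [hx, Real.mul_rpow hαb.le hl.le, ← Real.rpow_mul hα.le, one_div_mul_eq_div]
  have hxb' : α * l ^ b = x ^ b := by rw [hxb, div_self hb0.ne', Real.rpow_one]
  have h1 : 0 < x ^ b := by positivity
  rw [hxb', ← hxb, div_le_iff₀ (by positivity)]
  have h2 : 0 < x ^ p := by positivity
  rcases le_total x 1 with h | h
  · have := Real.rpow_le_rpow_of_exponent_ge hx0 h hpb
    nlinarith
  · have := Real.one_le_rpow h hp.le
    nlinarith

/-- With `α = (ε / E) ^ (b / (q + 1))` the two error contributions `ε α ^ (-1/b)` and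
`E α ^ (q/b)` balance. -/
theorem exists_rate {A : H →ₗ.[ℝ] H} (hA : IsSelfAdjoint A) {φ : HilbertBasis ℕ ℝ H}
    {lam : ℕ → ℝ} (hφ : ∀ n, ∃ h : φ n ∈ A.domain, A ⟨φ n, h⟩ = lam n • φ n)
    (hlam : ∀ n, 0 < lam n) {γ T b p q D : ℝ} (hγ0 : 0 < γ) (hγ1 : γ < 1) (hT : 0 < T)
    (hb : 1 ≤ b) (hq : 0 < q) (hD0 : 0 < D)
    (hD : ∀ α, 0 < α → ∀ n, α * lam n ^ b / (1 + α * lam n ^ b) ≤ D * α ^ (q / b) * lam n ^ p) :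
    ∃ C : ℝ, 0 < C ∧ ∀ (ε E : ℝ) (f : H) (u v : ℝ → H), 0 < ε → ε < E →
      IsParabolicSolution A γ T u → ‖u T - f‖ ≤ ε →
      u 0 ∈ powDomain φ lam p → powNorm φ lam p (u 0) ≤ E →
      IsRegularizedSolution φ lam γ T ((ε / E) ^ (b / (q + 1))) b f v →
      ‖u 0 - v 0‖ ≤ C * ε ^ (q / (q + 1)) * E ^ (1 / (q + 1)) := by
  have hΓ := Real.Gamma_pos_of_pos (sub_pos.2 hγ1)
  have hC := relaxConst_pos hγ0 hγ1
  have hTγ : 0 < T ^ γ := Real.rpow_pos_of_pos hT γ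
  refine ⟨(1 + Real.Gamma (1 - γ) * T ^ γ) + 2 * relaxConst γ * D, by positivity, ?_⟩
  intro ε E f u v hε hεE hu hf hu0 hE hv
  have hE0 : 0 < E := hε.trans hεE
  have hb0 : 0 < b := by linarith
  have hρ : 0 < ε / E := by positivity
  have hρ1 : ε / E ≤ 1 := (div_le_one hE0).2 hεE.le
  set α := (ε / E) ^ (b / (q + 1)) with hαdef
  have hα : 0 < α := Real.rpow_pos_of_pos hρ _
  have h1 : α ^ (-(1 / b)) = (ε / E) ^ (-(1 / (q + 1))) := by
    rw [hαdef, ← Real.rpow_mul hρ.le]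
    congr 1
    field_simp
  have h2 : α ^ (q / b) = (ε / E) ^ (q / (q + 1)) := by
    rw [hαdef, ← Real.rpow_mul hρ.le]
    congr 1
    field_simp
  have hge : 1 ≤ α ^ (-(1 / b)) := by
    rw [h1]
    exact Real.one_le_rpow_of_pos_of_le_one_of_nonpos hρ hρ1 (by simp; positivity)
  have hexp : q / (q + 1) = 1 + -(1 / (q + 1)) := by field_simp; ring
  have e2 : (ε / E) ^ (q / (q + 1)) * E = ε ^ (q / (q + 1)) * E ^ (1 / (q + 1)) := by
    rw [Real.div_rpow hε.le hE0.le, div_mul_eq_mul_div, mul_div_assoc]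
    congr 1
    rw [div_eq_iff (by positivity), ← Real.rpow_add hE0]
    rw [show 1 / (q + 1) + q / (q + 1) = 1 by field_simp; ring, Real.rpow_one]
  have e1 : (ε / E) ^ (-(1 / (q + 1))) * ε = ε ^ (q / (q + 1)) * E ^ (1 / (q + 1)) := by
    rw [← e2, hexp, Real.rpow_add hρ, Real.rpow_one]
    field_simp
  have key := norm_initial_sub_le (N := (1 + Real.Gamma (1 - γ) * T ^ γ) * α ^ (-(1 / b)))
    (D := D * α ^ (q / b)) hA hφ hlam hγ0 hγ1 hT hα hb (by positivity) (by positivity)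
    (fun n => ?_) (hD α hα) hu hu0 hv
  · refine key.trans ?_
    calc (1 + Real.Gamma (1 - γ) * T ^ γ) * α ^ (-(1 / b)) * ‖u T - f‖ +
          2 * relaxConst γ * (D * α ^ (q / b)) * powNorm φ lam p (u 0)
        ≤ (1 + Real.Gamma (1 - γ) * T ^ γ) * α ^ (-(1 / b)) * ε +
          2 * relaxConst γ * (D * α ^ (q / b)) * E := by gcongr
      _ = (1 + Real.Gamma (1 - γ) * T ^ γ) * (α ^ (-(1 / b)) * ε) +
          2 * relaxConst γ * D * (α ^ (q / b) * E) := by ring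
      _ = _ := by
        rw [h1, h2, e1, e2]
        ring
  · have := mul_le_mul_of_nonneg_left (symbol_le_rpow (hlam n) hα hb) (mul_pos hΓ hTγ).le
    linarith

end Hilbert

end SobolevReg
end

theorem theorem2 {H : Type*} [NormedAddCommGroup H] [InnerProductSpace ℝ H] [CompleteSpace H]
    (A : H →ₗ.[ℝ] H) (hA : IsSelfAdjoint A)
    (φ : HilbertBasis ℕ ℝ H) (lam : ℕ → ℝ)
    (hφ : ∀ n, ∃ h : φ n ∈ A.domain, A ⟨φ n, h⟩ = lam n • φ n)
    (hpos : 0 < lam 0) (hmono : Monotone lam) (hlim : Tendsto lam atTop atTop)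
    (γ : ℝ) (hγ0 : 0 < γ) (hγ1 : γ < 1) (T : ℝ) (hT : 0 < T) (b : ℝ) (hb : 1 ≤ b) :
    (∀ α : ℝ, 0 < α → SobolevReg.IsWellPosed φ lam γ T α b) ∧
    (∀ p : ℝ, 0 < p → p < b → ∃ C₁ : ℝ, 0 < C₁ ∧
      ∀ (ε E : ℝ) (f : H) (u v : ℝ → H), 0 < ε → ε < E →
        SobolevReg.IsParabolicSolution A γ T u → ‖u T - f‖ ≤ ε →
        u 0 ∈ SobolevReg.powDomain φ lam p → SobolevReg.powNorm φ lam p (u 0) ≤ E →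
        SobolevReg.IsRegularizedSolution φ lam γ T ((ε / E) ^ (b / (p + 1))) b f v →
        ‖u 0 - v 0‖ ≤ C₁ * ε ^ (p / (p + 1)) * E ^ (1 / (p + 1))) ∧
    (∀ p : ℝ, b ≤ p → ∃ C₂ : ℝ, 0 < C₂ ∧
      ∀ (ε E : ℝ) (f : H) (u v : ℝ → H), 0 < ε → ε < E →
        SobolevReg.IsParabolicSolution A γ T u → ‖u T - f‖ ≤ ε →
        u 0 ∈ SobolevReg.powDomain φ lam p → SobolevReg.powNorm φ lam p (u 0) ≤ E →
        SobolevReg.IsRegularizedSolution φ lam γ T ((ε / E) ^ (b / (b + 1))) b f v →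
        ‖u 0 - v 0‖ ≤ C₂ * ε ^ (b / (b + 1)) * E ^ (1 / (b + 1))) := by
  have hlam : ∀ n, 0 < lam n := fun n => hpos.trans_le (hmono (Nat.zero_le n))
  have hb0 : 0 < b := by linarith
  refine ⟨fun α hα => SobolevReg.isWellPosed φ hlam hγ0 hγ1 hT hα hb, fun p hp hpb => ?_,
    fun p hbp => ?_⟩
  · refine SobolevReg.exists_rate hA hφ hlam hγ0 hγ1 hT hb hp one_pos fun α hα n => ?_
    rw [one_mul]
    exact SobolevReg.filter_le_rpow (hlam n) hα hp hpb.le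
  · refine SobolevReg.exists_rate hA hφ hlam hγ0 hγ1 hT hb hb0
      (Real.rpow_pos_of_pos hpos (b - p)) fun α hα n => ?_
    have h1 : 0 < lam n ^ b := Real.rpow_pos_of_pos (hlam n) b
    have h2 : 0 < lam n ^ p := Real.rpow_pos_of_pos (hlam n) p
    have h3 : lam n ^ (b - p) ≤ lam 0 ^ (b - p) :=
      Real.rpow_le_rpow_of_nonpos hpos (hmono (Nat.zero_le n)) (by linarith)
    have h4 : lam n ^ b = lam n ^ (b - p) * lam n ^ p := by
      rw [← Real.rpow_add (hlam n), sub_add_cancel]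
    rw [div_self hb0.ne', Real.rpow_one]
    calc α * lam n ^ b / (1 + α * lam n ^ b) ≤ α * lam n ^ b :=
          div_le_self (by positivity) (by nlinarith [mul_pos hα h1])
      _ = lam n ^ (b - p) * α * lam n ^ p := by rw [h4]; ring
      _ ≤ lam 0 ^ (b - p) * α * lam n ^ p := by gcongr
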